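/- **Setting.** Let $n\ge 3$ and let $\mathbb R^{n+1,1}$ be $\mathbb R^{n+2}$ with a metric $(\cdot,\cdot)$ of signature $(n+1,1)$ and light cone $\mathcal L$. Identify $u\wedge v$ with the skew endomorphism $w\mapsto (u,w)v-(v,w)u$. Let $\Sigma$ be a Riemann surface with complex structure $J$, and let $\Lambda:\Sigma\to\mathbb P(\mathcal L)\cong S^n$ be a smooth conformal immersion (that is, $\Sigma$ is an oriented surface immersed by $\Lambda$ and equipped with the complex structure induced by $\Lambda$), regarded as a null line subbundle of $\Sigma\times\mathbb R^{n+1,1}$. For a local lift (nowhere-zero section) $\sigma$ of $\Lambda$ and a holomorphic coordinate $z$ put $\Lambda^{(1)}=\langle\sigma,d\sigma(T\Sigma)\rangle$ and $S=\langle\sigma,\sigma_z,\sigma_{\bar z},\sigma_{z\bar z}\rangle$ (the real form, i.e. the central sphere congruence); these do not depend on the choices. Write the trivial connection as $d=\mathcal D+\mathcal N$, where $\mathcal D$ is the sum of the connections induced by $d$ on $S$ and $S^{\perp}$. For an endomorphism-valued real 1-form $\alpha$ let $*\alpha=-\alpha\circ J$, $\alpha^{1,0}=\tfrac12(\alpha-i\,\alpha\circ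 J)$, $\alpha^{0,1}=\overline{\alpha^{1,0}}$, and $[\alpha\wedge\beta](X,Y)=[\alpha_X,\beta_Y]-[\alpha_Y,\beta_X]$. - $(\Lambda,\eta)$ is *isothermic* if $\Lambda$ is such a surface and $\eta\in\Omega^1(\Lambda\wedge\Lambda^{(1)})$ is a smooth real 1-form, not identically zero, with $d\eta=0$. - $\Lambda$ is a *$q$-constrained Willmore surface* if $q\in\Omega^1(\Lambda\wedge\Lambda^{(1)})$ is a smooth real 1-form with $d^{\mathcal D}q=0$ and $d^{\mathcal D}{*\mathcal N}=2[q\wedge *\mathcal N]$. - For $\lambda\in S^1\subset\mathbb C$ let $$d^\lambda_q=\mathcal D+\lambda^{-1}\mathcal N^{1,0}+\lambda\,\mathcal N^{0,1}+(\lambda^{-2}-1)q^{1,0}+(\lambda^2-1)q^{0,1}.$$ Let $\phi^\lambda_q:(\Sigma\times\mathbb R^{n+1,1},d^\lambda_q)\to(\Sigma\times\mathbb R^{n+1,1},d)$ be a smooth isometry of real bundles preserving connections, that is, $d(\phi^\lambda_q s)=\phi^\lambda_q(d^\lambda_q s)$ for all smooth local sections $s$. The line bundle $\phi^\lambda_q\Lambda$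 is the *spectral deformation* of $\Lambda$ of parameter $\lambda$. **Proposition.** Let $\Lambda$ be a $q$-constrained Willmore surface such that $(\Lambda,\eta)$ is isothermic, let $\lambda\in S^1$ and let $\phi=\phi^\lambda_q$ be as above. Then the form $$\mathrm{Ad}_{\phi}\,\eta_\lambda=\phi\,(\lambda^{-1}\eta^{1,0}+\lambda\,\eta^{0,1})\,\phi^{-1}$$ is real, and $(\phi\Lambda,\mathrm{Ad}_\phi\eta_\lambda)$ is isothermic: $\phi\Lambda$ is again a conformally immersed surface in $\mathbb P(\mathcal L)$, and $\mathrm{Ad}_\phi\eta_\lambda$ is a closed real 1-form, not identically zero, with values in $\phi\Lambda\wedge(\phi\Lambda)^{(1)}$. -/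

import Mathlib

open Matrix Topology Filter
open scoped ContDiff Manifold

noncomputable section

namespace LightCone

/-! ### Lorentzian linear algebra -/

/-- The vector space underlying `ℝ^{n+1,1}`; the last coordinate is the time-like one. -/
abbrev Vec (n : ℕ) : Type := Fin (n + 2) → ℝ

/-- Real endomorphisms of `ℝ^{n+1,1}`. -/
abbrev Mat (n : ℕ) : Type := Matrix (Fin (n + 2)) (Fin (n + 2)) ℝ

/-- Complex endomorphisms of the complexification of `ℝ^{n+1,1}`. -/
abbrev CMat (n : ℕ) : Type := Matrix (Fin (n + 2)) (Fin (n + 2)) ℂ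

/-- The Gram matrix `diag(1, …, 1, -1)`. -/
def gram (n : ℕ) : Mat n :=
  Matrix.diagonal fun i => if i = Fin.last (n + 1) then -1 else 1

/-- The metric of signature `(n+1,1)`. -/
def mink (n : ℕ) : LinearMap.BilinForm ℝ (Vec n) := Matrix.toBilin' (gram n)

theorem mink_apply {n : ℕ} (u v : Vec n) : mink n u v = u ⬝ᵥ (gram n *ᵥ v) := by
  simp [mink, Matrix.toBilin'_apply']

/-- Complexification of a real endomorphism. -/
def toC {n : ℕ} (T : Mat n) : CMat n := T.map (fun r : ℝ => (r : ℂ))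

/-- Complexification of a real vector. -/
def vecC {n : ℕ} (v : Vec n) : Fin (n + 2) → ℂ := fun i => (v i : ℂ)

/-- `u ∧ v` as a skew endomorphism: `(u ∧ v) w = (u, w) v - (v, w) u` (see `wedge_mulVec`). -/
def wedge {n : ℕ} (u v : Vec n) : Mat n :=
  Matrix.vecMulVec v (gram n *ᵥ u) - Matrix.vecMulVec u (gram n *ᵥ v)

theorem wedge_mulVec {n : ℕ} (u v w : Vec n) :
    wedge u v *ᵥ w = mink n u w • v - mink n v w • u := by
  have key : ∀ a b : Vec n, (gram n *ᵥ a) ⬝ᵥ b = mink n a b := by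
    intro a b
    rw [mink_apply]
    simp only [gram, dotProduct, Matrix.mulVec_diagonal]
    exact Finset.sum_congr rfl fun i _ => by ring
  rw [wedge, Matrix.sub_mulVec, Matrix.vecMulVec_mulVec, Matrix.vecMulVec_mulVec, key, key]
  simp

/-- `A ∧ B`, the span of all `u ∧ v` with `u ∈ A`, `v ∈ B`. -/
def wedgeSpan {n : ℕ} (A B : Submodule ℝ (Vec n)) : Submodule ℝ (Mat n) :=
  Submodule.span ℝ {T | ∃ u ∈ A, ∃ v ∈ B, T = wedge u v}

open Classical in
/-- Matrix of the orthogonal projection onto a non-degenerate subspace `S`, i.e. one with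
`ℝ^{n+1,1} = S ⊕ S^⊥`  (with the value `0` on degenerate subspaces, which do not occur as central
spheres of surfaces). -/
def orthProj {n : ℕ} (S : Submodule ℝ (Vec n)) : Mat n :=
  if h : IsCompl S ((mink n).orthogonal S) then
    LinearMap.toMatrix' (S.projection ((mink n).orthogonal S) h)
  else 0

/-! ### Types of 1-forms

The complex structure `J` of a tangent space of a Riemann surface is multiplication by `i`. -/

/-- The `(1,0)`-part `α^{1,0}(X) = (α(X) - i α(JX)) / 2` of a real 1-form at a point. -/
def part10 {n : ℕ} {T : Type*} [SMul ℂ T] (α : T → Mat n) (X : T) : CMat n :=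
  (1 / 2 : ℂ) • (toC (α X) - Complex.I • toC (α (Complex.I • X)))

/-- The `(0,1)`-part `α^{0,1}(X) = (α(X) + i α(JX)) / 2` of a real 1-form at a point. -/
def part01 {n : ℕ} {T : Type*} [SMul ℂ T] (α : T → Mat n) (X : T) : CMat n :=
  (1 / 2 : ℂ) • (toC (α X) + Complex.I • toC (α (Complex.I • X)))

/-- `l⁻¹ α^{1,0} + l α^{0,1}`. -/
def spectralForm {n : ℕ} {T : Type*} [SMul ℂ T] (l : ℂ) (α : T → Mat n) (X : T) : CMat n :=
  l⁻¹ • part10 α X + l • part01 α X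

/-! ### Matrix-valued 1-forms in a holomorphic coordinate

`ℂ` is the domain of the coordinate; a 1-form is a map `ℂ → (ℂ →ₗ[ℝ] Mat n)`. 2-forms are given by
their values on pairs `X, Y` of constant (coordinate) vector fields. Matrices are differentiated
entrywise. -/

/-- Matrix-valued 1-forms in a coordinate. -/
abbrev LForm (n : ℕ) : Type := ℂ → (ℂ →ₗ[ℝ] Mat n)

/-- The (entrywise) real differential of a matrix-valued function. -/
def dMat {n : ℕ} (A : ℂ → Mat n) (w : ℂ) : ℂ →ₗ[ℝ] Mat n where
  toFun X := Matrix.of fun i j => fderiv ℝ (fun y => A y i j) w X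
  map_add' X Y := by ext i j; simp
  map_smul' r X := by
    ext i j
    simp only [map_smul, Matrix.of_apply, Matrix.smul_apply, RingHom.id_apply]

/-- Exterior derivative `dα(X,Y) = X(α(Y)) - Y(α(X))` for constant vector fields `X, Y`. -/
def extD {n : ℕ} (α : LForm n) (w X Y : ℂ) : Mat n :=
  dMat (fun y => α y Y) w X - dMat (fun y => α y X) w Y

/-- `[α ∧ β](X,Y) = [α(X), β(Y)] - [α(Y), β(X)]`. -/
def bracketWedge {n : ℕ} (α β : LForm n) (w X Y : ℂ) : Mat n :=
  ⁅α w X, β w Y⁆ - ⁅α w Y, β w X⁆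

/-- Hodge star on 1-forms over a Riemann surface, `*α = -α ∘ J`. -/
def star1 {n : ℕ} (α : LForm n) : LForm n := fun w =>
  -(α w ∘ₗ LinearMap.mulLeft ℝ Complex.I)

/-! ### The splitting of the trivial connection by a family of projections -/

/-- The direct sum `𝒟` of the connections induced by `d` on the image and the kernel of the family
of projections `P`, applied to a section `s`. -/
def connD {n : ℕ} (P : ℂ → Mat n) (s : ℂ → Vec n) (w X : ℂ) : Vec n :=
  P w *ᵥ fderiv ℝ (fun y => P y *ᵥ s y) w X
    + (1 - P w) *ᵥ fderiv ℝ (fun y => (1 - P y) *ᵥ s y) w X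

/-- The 1-form `𝒩 = d - 𝒟` (see `fderiv_eq_connD_add_formN`). -/
def formN {n : ℕ} (P : ℂ → Mat n) : LForm n := fun w =>
  -(LinearMap.mulLeft ℝ (P w) ∘ₗ dMat P w
    + LinearMap.mulLeft ℝ (1 - P w) ∘ₗ dMat (fun y => 1 - P y) w)

theorem fderiv_mulVec_apply {n : ℕ} {A : ℂ → Mat n} {s : ℂ → Vec n} {w : ℂ}
    (hA : ∀ i j, DifferentiableAt ℝ (fun y => A y i j) w) (hs : DifferentiableAt ℝ s w) (X : ℂ) :
    fderiv ℝ (fun y => A y *ᵥ s y) w X = dMat A w X *ᵥ s w + A w *ᵥ fderiv ℝ s w X := by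
  have hs' : ∀ j, HasFDerivAt (fun y => s y j)
      ((ContinuousLinearMap.proj j).comp (fderiv ℝ s w)) w :=
    fun j => hasFDerivAt_pi'.1 hs.hasFDerivAt j
  have h : HasFDerivAt (fun y => A y *ᵥ s y)
      (ContinuousLinearMap.pi fun i => ∑ j, (A w i j • (ContinuousLinearMap.proj j).comp
        (fderiv ℝ s w) + s w j • fderiv ℝ (fun y => A y i j) w)) w := by
    refine hasFDerivAt_pi.2 fun i => ?_
    simp only [Matrix.mulVec, dotProduct]
    exact HasFDerivAt.fun_sum fun j _ => (hA i j).hasFDerivAt.mul (hs' j)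
  rw [h.fderiv]
  ext i
  simp [dMat, Matrix.mulVec, dotProduct, Finset.sum_add_distrib, add_comm, mul_comm]

theorem fderiv_eq_connD_add_formN {n : ℕ} {P : ℂ → Mat n} {s : ℂ → Vec n} {w : ℂ}
    (hP : ∀ i j, DifferentiableAt ℝ (fun y => P y i j) w) (hs : DifferentiableAt ℝ s w)
    (hPP : P w * P w = P w) (X : ℂ) :
    fderiv ℝ s w X = connD P s w X + formN P w X *ᵥ s w := by
  have hQ : ∀ i j, DifferentiableAt ℝ (fun y => (1 - P y) i j) w := fun i j => by
    simpa using (hP i j).const_sub ((1 : Mat n) i j)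
  have hQQ : (1 - P w) * (1 - P w) = 1 - P w := by
    simp [Matrix.mul_sub, Matrix.sub_mul, hPP]
  rw [connD, fderiv_mulVec_apply hP hs, fderiv_mulVec_apply hQ hs]
  have hd : (1 - P w) *ᵥ ((1 - P w) *ᵥ fderiv ℝ s w X) =
      fderiv ℝ s w X - P w *ᵥ fderiv ℝ s w X := by
    rw [Matrix.mulVec_mulVec, hQQ, Matrix.sub_mulVec, Matrix.one_mulVec]
  have hN : formN P w X = -(P w * dMat P w X + (1 - P w) * dMat (fun y => 1 - P y) w X) := rfl
  rw [hN, Matrix.mulVec_add (P w), Matrix.mulVec_add (1 - P w), hd, Matrix.neg_mulVec,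
    Matrix.add_mulVec, Matrix.mulVec_mulVec, Matrix.mulVec_mulVec, Matrix.mulVec_mulVec, hPP]
  abel

/-- Exterior covariant derivative `d^𝒟 α = dα - [𝒩 ∧ α]` of an endomorphism-valued 1-form, for the
connection `ξ ↦ 𝒟 ∘ ξ - ξ ∘ 𝒟 = dξ - [𝒩, ξ]` on endomorphisms. -/
def extCovD {n : ℕ} (P : ℂ → Mat n) (α : LForm n) (w X Y : ℂ) : Mat n :=
  extD α w X Y - bracketWedge (formN P) α w X Y

/-! ### Surfaces in a holomorphic coordinate

`L : ℂ → Submodule ℝ (Vec n)` is a family of subspaces depending on the coordinate. -/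

/-- `σ` is, near `w`, a smooth nowhere-zero section (a lift) of the line bundle `L`. -/
def IsLiftAt {n : ℕ} (L : ℂ → Submodule ℝ (Vec n)) (w : ℂ) (σ : ℂ → Vec n) : Prop :=
  ∀ᶠ y in 𝓝 w, ContDiffAt ℝ ∞ σ y ∧ σ y ≠ 0 ∧ L y = Submodule.span ℝ {σ y}

/-- `L^{(1)} = ⟨σ, dσ(T)⟩`. The span does not depend on the lift; all lifts are used at once. -/
def derived {n : ℕ} (L : ℂ → Submodule ℝ (Vec n)) (w : ℂ) : Submodule ℝ (Vec n) :=
  Submodule.span ℝ {v | ∃ σ, IsLiftAt L w σ ∧ (v = σ w ∨ ∃ X : ℂ, v = fderiv ℝ σ w X)}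

/-- The central sphere congruence `S = L^{(1)} + ⟨Δσ⟩ = ⟨σ, σ_z, σ_z̄, σ_{z z̄}⟩`; the Laplacian
with respect to a holomorphic coordinate is used. The span does not depend on the lift. -/
def centralSphere {n : ℕ} (L : ℂ → Submodule ℝ (Vec n)) (w : ℂ) : Submodule ℝ (Vec n) :=
  derived L w ⊔ Submodule.span ℝ {v | ∃ σ, IsLiftAt L w σ ∧ v = Laplacian.laplacian σ w}

/-- The family of orthogonal projections `π_S` onto the central spheres. -/
def projS {n : ℕ} (L : ℂ → Submodule ℝ (Vec n)) : ℂ → Mat n := fun w => orthProj (centralSphere L w)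

/-- On the open set `U`, `L` is a smooth null line bundle, an immersion into the projective light
cone (`L^{(1)}` has rank 3), and conformal. -/
def IsSurfaceOn {n : ℕ} (U : Set ℂ) (L : ℂ → Submodule ℝ (Vec n)) : Prop :=
  ∀ w ∈ U, (∃ σ, IsLiftAt L w σ) ∧ (∀ v ∈ L w, mink n v v = 0) ∧
    Module.finrank ℝ (derived L w) = 3 ∧
    ∀ σ, IsLiftAt L w σ → ∀ X Y : ℂ,
      mink n (fderiv ℝ σ w (Complex.I * X)) (fderiv ℝ σ w (Complex.I * Y)) =
        mink n (fderiv ℝ σ w X) (fderiv ℝ σ w Y)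

/-- On `U`, `α` is a smooth 1-form with values in `L ∧ L^{(1)}`. -/
def IsTangentialOn {n : ℕ} (U : Set ℂ) (L : ℂ → Submodule ℝ (Vec n)) (α : LForm n) : Prop :=
  (∀ X i j, ContDiffOn ℝ ∞ (fun w => α w X i j) U) ∧
    ∀ w ∈ U, ∀ X : ℂ, α w X ∈ wedgeSpan (L w) (derived L w)

/-- On `U`, `q` satisfies `d^𝒟 q = 0` and `d^𝒟 *𝒩 = 2 [q ∧ *𝒩]`. -/
def IsMultiplierOn {n : ℕ} (U : Set ℂ) (L : ℂ → Submodule ℝ (Vec n)) (q : LForm n) : Prop :=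
  ∀ w ∈ U, ∀ X Y : ℂ, extCovD (projS L) q w X Y = 0 ∧
    extCovD (projS L) (star1 (formN (projS L))) w X Y =
      (2 : ℝ) • bracketWedge q (star1 (formN (projS L))) w X Y

/-- The connection
`d^l_q = 𝒟 + l⁻¹ 𝒩^{1,0} + l 𝒩^{0,1} + (l⁻² - 1) q^{1,0} + (l² - 1) q^{0,1}`
applied to a real section `s`. -/
def spectralConn {n : ℕ} (L : ℂ → Submodule ℝ (Vec n)) (q : LForm n) (l : ℂ) (s : ℂ → Vec n)
    (w X : ℂ) : Fin (n + 2) → ℂ :=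
  vecC (connD (projS L) s w X)
    + (l⁻¹ • part10 (formN (projS L) w) X + l • part01 (formN (projS L) w) X
        + ((l ^ 2)⁻¹ - 1) • part10 (q w) X + (l ^ 2 - 1) • part01 (q w) X) *ᵥ vecC (s w)

/-! ### Global notions on a Riemann surface -/

section Global

variable {n : ℕ} {M : Type*} [TopologicalSpace M] [ChartedSpace ℂ M]

/-- Real 1-forms on the Riemann surface `M` with values in `End(ℝ^{n+1,1})`. -/
abbrev Form (n : ℕ) (M : Type*) [TopologicalSpace M] [ChartedSpace ℂ M] : Type _ :=
  ∀ x : M, TangentSpace 𝓘(ℂ) x →ₗ[ℝ] Mat n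

/-- `e` is a holomorphic chart of `M`. -/
def IsHolChart (e : OpenPartialHomeomorph M ℂ) : Prop := e ∈ IsManifold.maximalAtlas 𝓘(ℂ) ω M

/-- The expression of a 1-form in a chart: its pull-back by the inverse of the chart. -/
def localForm (e : OpenPartialHomeomorph M ℂ) (α : Form n M) : LForm n := fun w =>
  α (e.symm w) ∘ₗ ((mfderiv 𝓘(ℂ) 𝓘(ℂ) e.symm w).toLinearMap.restrictScalars ℝ)

/-- The expression of a family of lines in a chart. -/
def localLine (e : OpenPartialHomeomorph M ℂ) (Λ : M → Submodule ℝ (Vec n)) :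
    ℂ → Submodule ℝ (Vec n) := fun w => Λ (e.symm w)

/-- `Λ` is a conformally immersed surface in the projective light cone: a smooth null line
subbundle of the trivial bundle `M × ℝ^{n+1,1}`, immersive and conformal. -/
def IsSurface (Λ : M → Submodule ℝ (Vec n)) : Prop :=
  ∀ e : OpenPartialHomeomorph M ℂ, IsHolChart e → IsSurfaceOn e.target (localLine e Λ)

/-- `α ∈ Ω¹(Λ ∧ Λ^{(1)})`, smooth and real. -/
def IsTangential (Λ : M → Submodule ℝ (Vec n)) (α : Form n M) : Prop :=
  ∀ e : OpenPartialHomeomorph M ℂ, IsHolChart e →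
    IsTangentialOn e.target (localLine e Λ) (localForm e α)

/-- `dα = 0`. -/
def IsClosedForm (α : Form n M) : Prop :=
  ∀ e : OpenPartialHomeomorph M ℂ, IsHolChart e →
    ∀ w ∈ e.target, ∀ X Y : ℂ, extD (localForm e α) w X Y = 0

/-- `(Λ, η)` is an isothermic surface: `η` is a non-zero closed real 1-form with values in
`Λ ∧ Λ^{(1)}`. -/
structure IsIsothermic (Λ : M → Submodule ℝ (Vec n)) (η : Form n M) : Prop where
  surface : IsSurface Λ
  tangential : IsTangential Λ η
  closed : IsClosedForm η
  nonzero : ∃ x, η x ≠ 0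

/-- `Λ` is a `q`-constrained Willmore surface, i.e. `q` is a Lagrange multiplier for `Λ`. -/
structure IsConstrainedWillmore (Λ : M → Submodule ℝ (Vec n)) (q : Form n M) : Prop where
  surface : IsSurface Λ
  tangential : IsTangential Λ q
  multiplier : ∀ e : OpenPartialHomeomorph M ℂ, IsHolChart e →
    IsMultiplierOn e.target (localLine e Λ) (localForm e q)

/-- `φ : (M × ℝ^{n+1,1}, d^l_q) → (M × ℝ^{n+1,1}, d)` is a smooth isometry of real bundles
preserving connections: `d(φ s) = φ (d^l_q s)` for all smooth local sections `s`. -/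
structure IsSpectralGauge (Λ : M → Submodule ℝ (Vec n)) (q : Form n M) (l : ℂ)
    (φ : M → Mat n) : Prop where
  isometry : ∀ x, ∀ u v : Vec n, mink n (φ x *ᵥ u) (φ x *ᵥ v) = mink n u v
  smooth : ∀ e : OpenPartialHomeomorph M ℂ, IsHolChart e →
    ∀ i j, ContDiffOn ℝ ∞ (fun w => φ (e.symm w) i j) e.target
  parallel : ∀ e : OpenPartialHomeomorph M ℂ, IsHolChart e → ∀ w ∈ e.target,
    ∀ s : ℂ → Vec n, ContDiffAt ℝ ∞ s w → ∀ X : ℂ,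
      vecC (fderiv ℝ (fun y => φ (e.symm y) *ᵥ s y) w X) =
        toC (φ (e.symm w)) *ᵥ spectralConn (localLine e Λ) (localForm e q) l s w X

/-- The family of lines `φ Λ`. -/
def applyGauge (φ : M → Mat n) (Λ : M → Submodule ℝ (Vec n)) : M → Submodule ℝ (Vec n) :=
  fun x => (Λ x).map (Matrix.toLin' (φ x))

end Global

end LightCone

end

open LightCone

/-! For unimodular `l` the form `l⁻¹ α^{1,0} + l α^{0,1}` is the real form `α(l⁻¹ ·)`
(`spectralForm_eq`). Hence the spectral connection is `𝒟 + 𝒩(l⁻¹ ·) + q(l⁻² ·) - q`, and parallelism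
of `φ` says `dφ = φ B` with `B = 𝒩(l⁻¹ ·) - 𝒩 + q(l⁻² ·) - q` (`IsGaugeOn`).

Both `𝒩` and `q` annihilate `Λ`, so `d(φσ) = φ dσ` for every lift `σ` (`IsGaugeOn.fderiv_eq`).
Immersivity, conformality and the derived bundle are therefore carried over by the isometry `φ`.

For closedness, `d(Ad_φ η_l) = Ad_φ (dη_l + [B ∧ η_l])` with `η_l = η(l⁻¹ ·)`. The `q` terms drop
out because `Λ ∧ Λ^{(1)}` is abelian (`lie_eq_zero`). Two facts about `η` remain.

(1) `[𝒩 ∧ η] = 0` (`lie_formN_closed`): `η` is supported on `S`, so `[𝒩 ∧ η]` is the part of `dη`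
mixing `S` and `S^⊥`. Evaluated on rotated vectors, this kills the `𝒩(l⁻¹ ·)` term.

(2) `d^𝒟 η_l = 0` (`extD_rotate`). Since `η_l` is a pointwise real-linear combination, with constant
coefficients, of `η` and `*η`, and `d^𝒟 η = 0` by (1), it is enough that `d^𝒟 *η = 0`
(`divergence_eq`). This is the analytic heart. Write `η = σ ∧ (f σ_x + g σ_y)` on each of `∂_x`,
`∂_y`. Closedness makes the 2×2 coefficient matrix symmetric and trace-free (`coeff_relations`), and
its remaining tangential components are Cauchy-Riemann type equations. These make the divergence
equal to `σ ∧ V` with `V ⊥ σ, σ_x, σ_y`, whose compression to `S` vanishes (`proj_divergence`).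

The smoothness needed to differentiate `π_S` comes from an explicit formula for it in terms of a
lift (`frameProj`). -/

noncomputable section

namespace LightCone

variable {n : ℕ}

/-! ### Null vectors of the Lorentz metric -/

theorem mink_eq_sum (u v : Vec n) :
    mink n u v = ∑ i, (if i = Fin.last (n + 1) then -1 else 1) * (u i * v i) := by
  rw [mink_apply]
  simp only [gram, dotProduct, Matrix.mulVec_diagonal]
  exact Finset.sum_congr rfl fun i _ => by ring

theorem mink_comm (u v : Vec n) : mink n u v = mink n v u := by
  simp only [mink_eq_sum, mul_comm (u _)]

theorem gram_mul_gram : gram n * gram n = 1 := by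
  rw [gram, Matrix.diagonal_mul_diagonal, ← Matrix.diagonal_one]
  congr 1
  ext i
  split_ifs <;> norm_num

theorem eq_zero_of_mink_self_eq_zero {u : Vec n} (h : mink n u u = 0)
    (hl : u (Fin.last (n + 1)) = 0) : u = 0 := by
  rw [mink_eq_sum, Fin.sum_univ_castSucc] at h
  simp only [hl, Fin.castSucc_ne_last, if_false, mul_zero, add_zero, one_mul] at h
  rw [Finset.sum_eq_zero_iff_of_nonneg fun i _ => mul_self_nonneg _] at h
  ext i
  refine Fin.lastCases hl (fun j => ?_) i
  simpa using h j (Finset.mem_univ _)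

/-- Orthogonal null vectors are proportional. -/
theorem exists_smul_eq_of_null {u v : Vec n} (hu : mink n u u = 0) (hv : mink n v v = 0)
    (huv : mink n u v = 0) (hu0 : u ≠ 0) : ∃ c : ℝ, v = c • u := by
  -- The coefficients cancel the time coordinate; what is left is null and space-like, hence zero.
  have h : v (Fin.last _) • u - u (Fin.last _) • v = 0 := by
    refine eq_zero_of_mink_self_eq_zero ?_ (by simp [mul_comm])
    simp [hu, hv, huv, mink_comm v u]
  have h0 : u (Fin.last _) ≠ 0 := fun h0 => hu0 (eq_zero_of_mink_self_eq_zero hu h0)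
  refine ⟨v (Fin.last _) / u (Fin.last _), ?_⟩
  rw [sub_eq_zero] at h
  rw [div_eq_inv_mul, mul_smul, h, inv_smul_smul₀ h0]

/-- The rank one endomorphism `w ↦ (v, w) u`. -/
def dyad (u v : Vec n) : Mat n := Matrix.vecMulVec u (gram n *ᵥ v)

theorem dyad_mulVec (u v w : Vec n) : dyad u v *ᵥ w = mink n v w • u := by
  rw [dyad, Matrix.vecMulVec_mulVec]
  have : (gram n *ᵥ v) ⬝ᵥ w = mink n v w := by
    rw [mink_comm, mink_apply, dotProduct_comm]
  simp [this]

theorem mat_ext {A B : Mat n} (h : ∀ v, A *ᵥ v = B *ᵥ v) : A = B :=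
  Matrix.ext_of_mulVec_single fun _ => h _

/-! ### Algebra of skew endomorphisms `u ∧ v` -/

theorem wedge_add_right (u v w : Vec n) : wedge u (v + w) = wedge u v + wedge u w :=
  mat_ext fun x => by simp only [wedge_mulVec, add_mulVec, map_add, LinearMap.add_apply]; module

theorem wedge_smul_right (c : ℝ) (u v : Vec n) : wedge u (c • v) = c • wedge u v :=
  mat_ext fun x => by
    simp only [wedge_mulVec, smul_mulVec, map_smul, LinearMap.smul_apply, smul_eq_mul]; module

theorem wedge_smul_left (c : ℝ) (u v : Vec n) : wedge (c • u) v = c • wedge u v :=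
  mat_ext fun x => by
    simp only [wedge_mulVec, smul_mulVec, map_smul, LinearMap.smul_apply, smul_eq_mul]; module

theorem wedge_self (u : Vec n) : wedge u u = 0 :=
  mat_ext fun x => by simp [wedge_mulVec]

theorem wedge_comm (u v : Vec n) : wedge u v = -wedge v u :=
  mat_ext fun x => by simp [wedge_mulVec, neg_mulVec]

/-- Elements of `⟨s⟩ ∧ A`. -/
theorem mem_wedgeSpan_span_singleton {s : Vec n} {A : Submodule ℝ (Vec n)} {T : Mat n}
    (h : T ∈ wedgeSpan (Submodule.span ℝ {s}) A) : ∃ v ∈ A, T = wedge s v := by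
  induction h using Submodule.span_induction with
  | mem T h =>
    obtain ⟨u, hu, v, hv, rfl⟩ := h
    obtain ⟨c, rfl⟩ := Submodule.mem_span_singleton.1 hu
    exact ⟨c • v, A.smul_mem _ hv, by rw [wedge_smul_right, wedge_smul_left]⟩
  | zero => exact ⟨0, A.zero_mem, mat_ext fun x => by simp [wedge_mulVec]⟩
  | add T T' _ _ h h' =>
    obtain ⟨v, hv, rfl⟩ := h
    obtain ⟨v', hv', rfl⟩ := h'
    exact ⟨v + v', A.add_mem hv hv', (wedge_add_right _ _ _).symm⟩
  | smul c T _ h =>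
    obtain ⟨v, hv, rfl⟩ := h
    exact ⟨c • v, A.smul_mem _ hv, (wedge_smul_right _ _ _).symm⟩

/-- For null `s`, the endomorphisms `s ∧ v` with `v ⊥ s` commute. -/
theorem wedge_mul_wedge_comm {s u v : Vec n} (hs : mink n s s = 0) (hu : mink n s u = 0)
    (hv : mink n s v = 0) : wedge s u * wedge s v = wedge s v * wedge s u :=
  mat_ext fun x => by
    simp only [← mulVec_mulVec, wedge_mulVec, map_sub, map_smul, hs, hu, mink_comm u s,
      mink_comm v s, hv, smul_eq_mul, mul_zero, sub_zero, zero_smul, zero_sub, mink_comm u v,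
      ← neg_smul]

/-! ### Orthogonal projections -/

/-- Allows the case-split definition to be replaced by an explicit matrix: `hnd` gives disjointness
from the complement, and `v = Pv + (v - Pv)` gives codisjointness, so the default value `0` is
avoided. -/
theorem orthProj_eq {S : Submodule ℝ (Vec n)} {P : Mat n} (hmem : ∀ v, P *ᵥ v ∈ S)
    (horth : ∀ v, ∀ s ∈ S, mink n s (v - P *ᵥ v) = 0)
    (hnd : ∀ x ∈ S, (∀ s ∈ S, mink n s x = 0) → x = 0) : orthProj S = P := by
  have hc : IsCompl S ((mink n).orthogonal S) := by
    constructor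
    · rw [Submodule.disjoint_def]
      exact fun x hx hx' => hnd x hx fun s hs => hx' s hs
    · rw [codisjoint_iff, eq_top_iff]
      intro v _
      exact Submodule.mem_sup.2 ⟨P *ᵥ v, hmem v, v - P *ᵥ v, fun s hs => horth v s hs, by simp⟩
  rw [orthProj, dif_pos hc]
  refine mat_ext fun v => ?_
  rw [LinearMap.toMatrix'_mulVec]
  have h1 : v = P *ᵥ v + (v - P *ᵥ v) := by simp
  have h2 := Submodule.projection_apply_left hc ⟨P *ᵥ v, hmem v⟩
  have h3 := (Submodule.projection_apply_eq_zero_iff hc (x := v - P *ᵥ v)).2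
    fun s hs => horth v s hs
  conv_lhs => rw [h1, map_add, h3, add_zero]
  exact h2

/-- The Gram relations of a lift `s` of a conformal immersion, its coordinate derivatives `a`, `b`,
and its Laplacian `z`. -/
structure IsFrame (s a b z : Vec n) : Prop where
  ss : mink n s s = 0
  sa : mink n s a = 0
  sb : mink n s b = 0
  ab : mink n a b = 0
  bb : mink n b b = mink n a a
  sz : mink n s z = -2 * mink n a a
  aa : mink n a a ≠ 0

/-- The part of `z` orthogonal to `a` and `b`. -/
def normalPart (a b z : Vec n) : Vec n :=
  z - ((mink n a a)⁻¹ * mink n a z) • a - ((mink n a a)⁻¹ * mink n b z) • b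

/-- The null vector congruent to `z` modulo `s, a, b` and orthogonal to `a` and `b`. -/
def nullPart (s a b z : Vec n) : Vec n :=
  normalPart a b z +
    ((mink n a a)⁻¹ * (1 / 4) * mink n (normalPart a b z) (normalPart a b z)) • s

/-- The projection onto `⟨s, a, b, z⟩`. -/
def frameProj (s a b z : Vec n) : Mat n :=
  (mink n a a)⁻¹ • (dyad a a + dyad b b -
    (1 / 2 : ℝ) • (dyad s (nullPart s a b z) + dyad (nullPart s a b z) s))

/-- On a frame this is a dual-basis expansion: `a`, `b` are orthogonal of equal square, and `s` and
the null part are null vectors with product `-2 (a, a)`, orthogonal to both. This product accounts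
for the factor `-1/2`. -/
theorem frameProj_mulVec (s a b z v : Vec n) :
    frameProj s a b z *ᵥ v = (mink n a a)⁻¹ • (mink n a v • a + mink n b v • b -
      (1 / 2 : ℝ) • (mink n (nullPart s a b z) v • s + mink n s v • nullPart s a b z)) := by
  simp only [frameProj, smul_mulVec, sub_mulVec, add_mulVec, dyad_mulVec]

theorem frameProj_selfAdjoint (s a b z u v : Vec n) :
    mink n (frameProj s a b z *ᵥ u) v = mink n u (frameProj s a b z *ᵥ v) := by
  simp only [frameProj_mulVec, map_smul, map_add, map_sub, LinearMap.smul_apply,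
    LinearMap.add_apply, LinearMap.sub_apply, smul_eq_mul, mink_comm u a, mink_comm u b,
    mink_comm u s, mink_comm u (nullPart s a b z)]
  ring

namespace IsFrame

variable {s a b z : Vec n}

theorem mink_normalPart_left {x : Vec n} (hx : mink n x a = 0) (hx' : mink n x b = 0) :
    mink n x (normalPart a b z) = mink n x z := by
  simp [normalPart, hx, hx']

theorem a_normalPart (h : IsFrame s a b z) : mink n a (normalPart a b z) = 0 := by
  have := h.aa
  simp only [normalPart, map_sub, map_smul, h.ab, smul_eq_mul]
  field_simp
  ring

theorem b_normalPart (h : IsFrame s a b z) : mink n b (normalPart a b z) = 0 := by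
  have := h.aa
  simp only [normalPart, map_sub, map_smul, h.bb, mink_comm b a, h.ab, smul_eq_mul]
  field_simp
  ring

theorem s_normalPart (h : IsFrame s a b z) : mink n s (normalPart a b z) = -2 * mink n a a := by
  rw [mink_normalPart_left h.sa h.sb, h.sz]

theorem a_nullPart (h : IsFrame s a b z) : mink n a (nullPart s a b z) = 0 := by
  simp [nullPart, h.a_normalPart, mink_comm a s, h.sa]

theorem b_nullPart (h : IsFrame s a b z) : mink n b (nullPart s a b z) = 0 := by
  simp [nullPart, h.b_normalPart, mink_comm b s, h.sb]

theorem s_nullPart (h : IsFrame s a b z) : mink n s (nullPart s a b z) = -2 * mink n a a := by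
  simp [nullPart, h.s_normalPart, h.ss]

/-- With `m` the normal part, `(m + t s, m + t s) = (m, m) - 4 t (a, a)`; the coefficient of `s` in
`nullPart` is the root `t`. -/
theorem null_nullPart (h : IsFrame s a b z) : mink n (nullPart s a b z) (nullPart s a b z) = 0 := by
  have := h.aa
  have h1 : mink n (nullPart s a b z) (nullPart s a b z) =
      mink n (normalPart a b z) (nullPart s a b z) +
      ((mink n a a)⁻¹ * (1 / 4) * mink n (normalPart a b z) (normalPart a b z)) *
        mink n s (nullPart s a b z) := by
    conv_lhs => enter [1]; rw [nullPart]
    rw [map_add, map_smul, LinearMap.add_apply, LinearMap.smul_apply, smul_eq_mul]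
  rw [h1, h.s_nullPart, nullPart, map_add, map_smul, mink_comm _ s, h.s_normalPart]
  simp only [smul_eq_mul]
  field_simp
  ring

theorem proj_s (h : IsFrame s a b z) : frameProj s a b z *ᵥ s = s := by
  have := h.aa
  rw [frameProj_mulVec, mink_comm a s, mink_comm b s, mink_comm _ s, h.sa, h.sb, h.ss, h.s_nullPart]
  simp only [smul_smul, zero_smul, add_zero, zero_sub, ← neg_smul]
  rw [show (mink n a a)⁻¹ * -(1 / 2 * (-2 * mink n a a)) = 1 by field_simp, one_smul]

theorem proj_a (h : IsFrame s a b z) : frameProj s a b z *ᵥ a = a := by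
  have := h.aa
  rw [frameProj_mulVec, mink_comm b a, h.sa, h.ab, mink_comm (nullPart s a b z) a, h.a_nullPart]
  simp [this]

theorem proj_b (h : IsFrame s a b z) : frameProj s a b z *ᵥ b = b := by
  have := h.aa
  rw [frameProj_mulVec, h.sb, h.ab, mink_comm (nullPart s a b z) b, h.b_nullPart, h.bb]
  simp [this]

theorem proj_nullPart (h : IsFrame s a b z) : frameProj s a b z *ᵥ nullPart s a b z = nullPart s a b z := by
  have := h.aa
  rw [frameProj_mulVec, h.a_nullPart, h.b_nullPart, h.s_nullPart, h.null_nullPart]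
  simp only [smul_smul, zero_smul, zero_sub, zero_add, ← neg_smul]
  rw [show (mink n a a)⁻¹ * -(1 / 2 * (-2 * mink n a a)) = 1 by field_simp, one_smul]

theorem eq_nullPart (s a b z : Vec n) : ∃ x y w : ℝ, z = nullPart s a b z + x • a + y • b + w • s := by
  refine ⟨(mink n a a)⁻¹ * mink n a z, (mink n a a)⁻¹ * mink n b z,
    -((mink n a a)⁻¹ * (1 / 4) * mink n (normalPart a b z) (normalPart a b z)), ?_⟩
  simp only [nullPart]
  conv_lhs => rw [show z = normalPart a b z + ((mink n a a)⁻¹ * mink n a z) • a +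
    ((mink n a a)⁻¹ * mink n b z) • b by rw [normalPart]; abel]
  module

theorem proj_z (h : IsFrame s a b z) : frameProj s a b z *ᵥ z = z := by
  obtain ⟨x, y, w, hz⟩ := eq_nullPart s a b z
  have : frameProj s a b z *ᵥ (nullPart s a b z + x • a + y • b + w • s) =
      nullPart s a b z + x • a + y • b + w • s := by
    simp only [mulVec_add, mulVec_smul, h.proj_a, h.proj_b, h.proj_s, h.proj_nullPart]
  rwa [← hz] at this

theorem proj_mem (v : Vec n) : frameProj s a b z *ᵥ v ∈ Submodule.span ℝ {s, a, b, z} := by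
  have hs : s ∈ Submodule.span ℝ {s, a, b, z} := Submodule.subset_span (by simp)
  have ha : a ∈ Submodule.span ℝ {s, a, b, z} := Submodule.subset_span (by simp)
  have hb : b ∈ Submodule.span ℝ {s, a, b, z} := Submodule.subset_span (by simp)
  have hz : z ∈ Submodule.span ℝ {s, a, b, z} := Submodule.subset_span (by simp)
  have hN : nullPart s a b z ∈ Submodule.span ℝ {s, a, b, z} := by
    rw [nullPart, normalPart]
    exact add_mem (sub_mem (sub_mem hz (Submodule.smul_mem _ _ ha)) (Submodule.smul_mem _ _ hb))
      (Submodule.smul_mem _ _ hs)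
  rw [frameProj_mulVec]
  exact Submodule.smul_mem _ _ (sub_mem (add_mem (Submodule.smul_mem _ _ ha)
    (Submodule.smul_mem _ _ hb)) (Submodule.smul_mem _ _ (add_mem (Submodule.smul_mem _ _ hs)
    (Submodule.smul_mem _ _ hN))))

theorem proj_of_mem (h : IsFrame s a b z) {v : Vec n} (hv : v ∈ Submodule.span ℝ {s, a, b, z}) :
    frameProj s a b z *ᵥ v = v := by
  induction hv using Submodule.span_induction with
  | mem v hv =>
    rcases hv with rfl | rfl | rfl | rfl
    exacts [h.proj_s, h.proj_a, h.proj_b, h.proj_z]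
  | zero => simp
  | add u v _ _ hu hv => rw [mulVec_add, hu, hv]
  | smul c v _ hv => rw [mulVec_smul, hv]

theorem proj_mul_self (h : IsFrame s a b z) : frameProj s a b z * frameProj s a b z = frameProj s a b z :=
  mat_ext fun v => by rw [← mulVec_mulVec, h.proj_of_mem (proj_mem v)]

theorem orthProj_span (h : IsFrame s a b z) : orthProj (Submodule.span ℝ {s, a, b, z}) = frameProj s a b z := by
  refine orthProj_eq proj_mem (fun v x hx => ?_) fun x hx hx' => ?_
  · rw [map_sub, ← frameProj_selfAdjoint, h.proj_of_mem hx, sub_self]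
  · rw [← h.proj_of_mem hx, frameProj_mulVec]
    have hN : nullPart s a b z ∈ Submodule.span ℝ {s, a, b, z} := by
      rw [← h.proj_nullPart]; exact proj_mem _
    rw [hx' s (Submodule.subset_span (by simp)), hx' a (Submodule.subset_span (by simp)),
      hx' b (Submodule.subset_span (by simp)), hx' _ hN]
    simp

/-- Inside the span of the frame, the orthogonal complement of `⟨s, a, b⟩` is the null line `⟨s⟩`.
-/
theorem proj_of_orthogonal {v : Vec n} (hs : mink n s v = 0) (ha : mink n a v = 0)
    (hb : mink n b v = 0) : ∃ c : ℝ, frameProj s a b z *ᵥ v = c • s := by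
  refine ⟨(mink n a a)⁻¹ * (-(1 / 2) * mink n (nullPart s a b z) v), ?_⟩
  rw [frameProj_mulVec, hs, ha, hb]
  module

end IsFrame

/-! ### Entrywise calculus of matrix-valued functions -/

/-- Entrywise differentiability. -/
def MatDiffAt (A : ℂ → Mat n) (w : ℂ) : Prop := ∀ i j, DifferentiableAt ℝ (fun y => A y i j) w

/-- Entrywise smoothness. -/
def MatSmoothAt (A : ℂ → Mat n) (w : ℂ) : Prop := ∀ i j, ContDiffAt ℝ ∞ (fun y => A y i j) w

theorem MatSmoothAt.diff {A : ℂ → Mat n} {w : ℂ} (h : MatSmoothAt A w) : MatDiffAt A w :=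
  fun i j => (h i j).differentiableAt (by simp)

theorem MatSmoothAt.congr {A B : ℂ → Mat n} {w : ℂ} (h : MatSmoothAt A w) (hAB : B =ᶠ[𝓝 w] A) :
    MatSmoothAt B w :=
  fun i j => (h i j).congr_of_eventuallyEq (hAB.mono fun y hy => by simp only [hy])

theorem MatSmoothAt.mul {A B : ℂ → Mat n} {w : ℂ} (hA : MatSmoothAt A w) (hB : MatSmoothAt B w) :
    MatSmoothAt (fun y => A y * B y) w := fun i j => by
  simp only [Matrix.mul_apply]
  exact ContDiffAt.sum fun k _ => (hA i k).mul (hB k j)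

theorem MatSmoothAt.transpose {A : ℂ → Mat n} {w : ℂ} (hA : MatSmoothAt A w) :
    MatSmoothAt (fun y => (A y)ᵀ) w := fun i j => hA j i

theorem matSmoothAt_const (A : Mat n) (w : ℂ) : MatSmoothAt (fun _ => A) w :=
  fun _ _ => contDiffAt_const

theorem MatSmoothAt.mulVec {A : ℂ → Mat n} {s : ℂ → Vec n} {w : ℂ} (hA : MatSmoothAt A w)
    (hs : ContDiffAt ℝ ∞ s w) : ContDiffAt ℝ ∞ (fun y => A y *ᵥ s y) w := by
  rw [contDiffAt_pi]
  intro i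
  simp only [Matrix.mulVec, dotProduct]
  exact ContDiffAt.sum fun j _ => (hA i j).mul (contDiffAt_pi.1 hs j)

theorem dMat_apply (A : ℂ → Mat n) (w X : ℂ) (i j : Fin (n + 2)) :
    dMat A w X i j = fderiv ℝ (fun y => A y i j) w X := rfl

theorem dMat_congr {A B : ℂ → Mat n} {w : ℂ} (h : A =ᶠ[𝓝 w] B) : dMat A w = dMat B w := by
  ext X i j
  simp only [dMat_apply]
  have h' : (fun y => A y i j) =ᶠ[𝓝 w] fun y => B y i j := h.mono fun y hy => by simp only [hy]
  rw [h'.fderiv_eq]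

theorem dMat_const (A : Mat n) (w : ℂ) : dMat (fun _ => A) w = 0 := by
  ext X i j
  simp [dMat_apply]

theorem dMat_const_sub (A : Mat n) (B : ℂ → Mat n) (w : ℂ) :
    dMat (fun y => A - B y) w = -dMat B w := by
  ext X i j
  simp [dMat_apply, fderiv_const_sub]

theorem dMat_add {A B : ℂ → Mat n} {w : ℂ} (hA : MatDiffAt A w) (hB : MatDiffAt B w) :
    dMat (fun y => A y + B y) w = dMat A w + dMat B w := by
  ext X i j
  simp only [dMat_apply, LinearMap.add_apply, Matrix.add_apply]
  rw [fderiv_fun_add (hA i j) (hB i j)]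
  rfl

theorem dMat_const_smul {A : ℂ → Mat n} {w : ℂ} (c : ℝ) (hA : MatDiffAt A w) :
    dMat (fun y => c • A y) w = c • dMat A w := by
  ext X i j
  simp only [dMat_apply, LinearMap.smul_apply, Matrix.smul_apply]
  rw [fderiv_fun_const_smul (hA i j)]
  rfl

theorem dMat_mul {A B : ℂ → Mat n} {w : ℂ} (hA : MatDiffAt A w) (hB : MatDiffAt B w) (X : ℂ) :
    dMat (fun y => A y * B y) w X = dMat A w X * B w + A w * dMat B w X := by
  ext i j
  simp only [dMat_apply, Matrix.add_apply, Matrix.mul_apply, ← Finset.sum_add_distrib]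
  rw [fderiv_fun_sum fun k _ => (hA i k).fun_mul (hB k j), _root_.sum_apply]
  refine Finset.sum_congr rfl fun k _ => ?_
  rw [fderiv_fun_mul (hA i k) (hB k j)]
  simp [mul_comm, add_comm]

theorem MatDiffAt.mul {A B : ℂ → Mat n} {w : ℂ} (hA : MatDiffAt A w) (hB : MatDiffAt B w) :
    MatDiffAt (fun y => A y * B y) w := fun i j => by
  simp only [Matrix.mul_apply]
  exact DifferentiableAt.fun_sum fun k _ => (hA i k).mul (hB k j)

theorem hasFDerivAt_coord {s : ℂ → Vec n} {w : ℂ} (hs : DifferentiableAt ℝ s w) (i : Fin (n + 2)) :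
    HasFDerivAt (fun y => s y i) ((ContinuousLinearMap.proj i).comp (fderiv ℝ s w)) w :=
  hasFDerivAt_pi'.1 hs.hasFDerivAt i

theorem fderiv_mink {u v : ℂ → Vec n} {w : ℂ} (hu : DifferentiableAt ℝ u w)
    (hv : DifferentiableAt ℝ v w) (X : ℂ) :
    fderiv ℝ (fun y => mink n (u y) (v y)) w X =
      mink n (fderiv ℝ u w X) (v w) + mink n (u w) (fderiv ℝ v w X) := by
  simp only [mink_eq_sum]
  have h := HasFDerivAt.fun_sum (u := Finset.univ) fun i _ =>
    ((hasFDerivAt_coord hu i).fun_mul (hasFDerivAt_coord hv i)).const_mul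
      (if i = Fin.last (n + 1) then (-1 : ℝ) else 1)
  rw [h.fderiv, _root_.sum_apply, ← Finset.sum_add_distrib]
  refine Finset.sum_congr rfl fun i _ => ?_
  split_ifs <;> simp <;> ring

theorem contDiffAt_mink {u v : ℂ → Vec n} {w : ℂ} (hu : ContDiffAt ℝ ∞ u w)
    (hv : ContDiffAt ℝ ∞ v w) : ContDiffAt ℝ ∞ (fun y => mink n (u y) (v y)) w := by
  simp only [mink_eq_sum]
  exact ContDiffAt.sum fun i _ =>
    contDiffAt_const.mul ((contDiffAt_pi.1 hu i).mul (contDiffAt_pi.1 hv i))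

theorem dyad_apply (u v : Vec n) (i j : Fin (n + 2)) :
    dyad u v i j = u i * ((if j = Fin.last (n + 1) then -1 else 1) * v j) := by
  simp [dyad, Matrix.vecMulVec_apply, gram, Matrix.mulVec_diagonal]

theorem wedge_eq_dyad (u v : Vec n) : wedge u v = dyad v u - dyad u v := rfl

theorem matSmoothAt_dyad {u v : ℂ → Vec n} {w : ℂ} (hu : ContDiffAt ℝ ∞ u w)
    (hv : ContDiffAt ℝ ∞ v w) : MatSmoothAt (fun y => dyad (u y) (v y)) w := fun i j => by
  simp only [dyad_apply]
  exact (contDiffAt_pi.1 hu i).mul (contDiffAt_const.mul (contDiffAt_pi.1 hv j))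

theorem dMat_wedge {u v : ℂ → Vec n} {w : ℂ} (hu : DifferentiableAt ℝ u w)
    (hv : DifferentiableAt ℝ v w) (X : ℂ) :
    dMat (fun y => wedge (u y) (v y)) w X =
      wedge (fderiv ℝ u w X) (v w) + wedge (u w) (fderiv ℝ v w X) := by
  ext i j
  simp only [dMat_apply, wedge_eq_dyad, Matrix.sub_apply, Matrix.add_apply, dyad_apply]
  have h := ((hasFDerivAt_coord hv i).fun_mul ((hasFDerivAt_coord hu j).const_mul
      (if j = Fin.last (n + 1) then (-1 : ℝ) else 1))).fun_sub
    ((hasFDerivAt_coord hu i).fun_mul ((hasFDerivAt_coord hv j).const_mul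
      (if j = Fin.last (n + 1) then (-1 : ℝ) else 1)))
  rw [h.fderiv]
  split_ifs <;> simp <;> ring

/-! ### Coordinate derivatives -/

section

variable {E : Type*} [NormedAddCommGroup E] [NormedSpace ℝ E]

/-- The derivative in the constant direction `v`. -/
def pd (v : ℂ) (f : ℂ → E) : ℂ → E := fun y => fderiv ℝ f y v

theorem contDiffAt_pd {f : ℂ → E} {w : ℂ} (hf : ContDiffAt ℝ ∞ f w) (v : ℂ) :
    ContDiffAt ℝ ∞ (pd v f) w :=
  (hf.fderiv_right (m := ∞) (by simp)).clm_apply contDiffAt_const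

theorem pd_congr {f g : ℂ → E} {w : ℂ} (h : f =ᶠ[𝓝 w] g) (v : ℂ) : pd v f =ᶠ[𝓝 w] pd v g :=
  (h.fderiv (𝕜 := ℝ)).mono fun y hy => by simp only [pd, hy]

theorem fderiv_eq_pd (f : ℂ → E) (w X : ℂ) :
    fderiv ℝ f w X = X.re • pd 1 f w + X.im • pd Complex.I f w := by
  conv_lhs => rw [← Complex.re_add_im X]
  rw [show (X.re : ℂ) + X.im * Complex.I = X.re • (1 : ℂ) + X.im • Complex.I by simp,
    map_add, map_smul, map_smul]
  rfl

theorem pd_pd_eq {f : ℂ → E} {w : ℂ} (hf : ContDiffAt ℝ ∞ f w) (u v : ℂ) :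
    pd u (pd v f) w = fderiv ℝ (fderiv ℝ f) w u v := by
  have h : DifferentiableAt ℝ (fderiv ℝ f) w :=
    (hf.fderiv_right (m := ∞) (by simp)).differentiableAt (by simp)
  have e : pd v f = fun y => fderiv ℝ f y v := rfl
  rw [pd, e, fderiv_clm_apply h (differentiableAt_const v)]
  simp

theorem pd_comm {f : ℂ → E} {w : ℂ} (hf : ContDiffAt ℝ ∞ f w) (u v : ℂ) :
    pd u (pd v f) w = pd v (pd u f) w := by
  rw [pd_pd_eq hf, pd_pd_eq hf]
  exact (hf.isSymmSndFDerivAt (by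
    rw [minSmoothness_of_isRCLikeNormedField]; exact ENat.LEInfty.out)) u v

theorem laplacian_eq_pd {f : ℂ → E} {w : ℂ} (hf : ContDiffAt ℝ ∞ f w) :
    Laplacian.laplacian f w = pd 1 (pd 1 f) w + pd Complex.I (pd Complex.I f) w := by
  rw [pd_pd_eq hf, pd_pd_eq hf, InnerProductSpace.laplacian_eq_iteratedFDeriv_complexPlane]
  simp [iteratedFDeriv_two_apply]

theorem pd_smul {f : ℂ → ℝ} {σ : ℂ → E} {w : ℂ} (hf : DifferentiableAt ℝ f w)
    (hσ : DifferentiableAt ℝ σ w) (v : ℂ) :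
    pd v (fun y => f y • σ y) w = f w • pd v σ w + pd v f w • σ w := by
  simp only [pd]
  rw [fderiv_fun_smul hf hσ]
  simp

theorem ContDiffAt.eventually_differentiableAt {f : ℂ → E} {w : ℂ} (hf : ContDiffAt ℝ ∞ f w) :
    ∀ᶠ y in 𝓝 w, DifferentiableAt ℝ f y :=
  ((hf.of_le (m := 1) (by exact_mod_cast le_top)).eventually (by simp)).mono
    fun _ hy => hy.differentiableAt (by simp)

theorem pd_pd_smul {f : ℂ → ℝ} {σ : ℂ → E} {w : ℂ} (hf : ContDiffAt ℝ ∞ f w)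
    (hσ : ContDiffAt ℝ ∞ σ w) (v : ℂ) :
    pd v (pd v fun y => f y • σ y) w =
      f w • pd v (pd v σ) w + (2 * pd v f w) • pd v σ w + pd v (pd v f) w • σ w := by
  have h : (pd v fun y => f y • σ y) =ᶠ[𝓝 w] fun y => f y • pd v σ y + pd v f y • σ y := by
    filter_upwards [ContDiffAt.eventually_differentiableAt hf,
      ContDiffAt.eventually_differentiableAt hσ] with y h1 h2
    exact pd_smul h1 h2 v
  have hf' := hf.differentiableAt (by simp)
  have hσ' := hσ.differentiableAt (by simp)
  have hpf := (contDiffAt_pd hf v).differentiableAt (by simp)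
  have hpσ := (contDiffAt_pd hσ v).differentiableAt (by simp)
  rw [(pd_congr h v).eq_of_nhds]
  have h3 : pd v (fun y => f y • pd v σ y + pd v f y • σ y) w =
      pd v (fun y => f y • pd v σ y) w + pd v (fun y => pd v f y • σ y) w := by
    rw [pd, fderiv_fun_add (hf'.fun_smul hpσ) (hpf.fun_smul hσ')]
    rfl
  rw [h3, pd_smul hf' hpσ, pd_smul hpf hσ']
  module

end

/-! ### Lifts -/

namespace IsLiftAt

variable {L : ℂ → Submodule ℝ (Vec n)} {w : ℂ} {σ τ : ℂ → Vec n}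

theorem eventually (h : IsLiftAt L w σ) : ∀ᶠ y in 𝓝 w, IsLiftAt L y σ := eventually_eventually_nhds.2 h

theorem smooth (h : IsLiftAt L w σ) : ContDiffAt ℝ ∞ σ w := h.self_of_nhds.1

theorem diff (h : IsLiftAt L w σ) : DifferentiableAt ℝ σ w := h.smooth.differentiableAt (by simp)

theorem ne_zero (h : IsLiftAt L w σ) : σ w ≠ 0 := h.self_of_nhds.2.1

theorem span_eq (h : IsLiftAt L w σ) : L w = Submodule.span ℝ {σ w} := h.self_of_nhds.2.2

theorem mem (h : IsLiftAt L w σ) : σ w ∈ L w := h.span_eq ▸ Submodule.mem_span_singleton_self _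

/-- Two lifts differ by a smooth factor, namely the quotient of a coordinate in which `σ w` does not
vanish. Independence of the lift below rests on this. -/
theorem exists_ratio (hσ : IsLiftAt L w σ) (hτ : IsLiftAt L w τ) :
    ∃ f : ℂ → ℝ, ContDiffAt ℝ ∞ f w ∧ τ =ᶠ[𝓝 w] fun y => f y • σ y := by
  obtain ⟨i, hi⟩ := Function.ne_iff.1 hσ.ne_zero
  have hσi := contDiffAt_pi.1 hσ.smooth i
  refine ⟨fun y => τ y i / σ y i, (contDiffAt_pi.1 hτ.smooth i).div hσi hi, ?_⟩
  filter_upwards [hσ.eventually, hτ.eventually, hσi.continuousAt.eventually_ne hi] with y h1 h2 h3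
  have h4 := h2.mem
  rw [h1.span_eq] at h4
  obtain ⟨c, hc⟩ := Submodule.mem_span_singleton.1 h4
  rw [← hc, Pi.smul_apply, smul_eq_mul, mul_div_assoc, div_self h3, mul_one]

theorem derived_eq (hσ : IsLiftAt L w σ) :
    derived L w = Submodule.span ℝ {σ w, pd 1 σ w, pd Complex.I σ w} := by
  apply le_antisymm
  · refine Submodule.span_le.2 ?_
    have hs : σ w ∈ Submodule.span ℝ {σ w, pd 1 σ w, pd Complex.I σ w} :=
      Submodule.subset_span (by simp)
    have h1 : pd 1 σ w ∈ Submodule.span ℝ {σ w, pd 1 σ w, pd Complex.I σ w} :=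
      Submodule.subset_span (by simp)
    have h2 : pd Complex.I σ w ∈ Submodule.span ℝ {σ w, pd 1 σ w, pd Complex.I σ w} :=
      Submodule.subset_span (by simp)
    rintro v ⟨τ, hτ, hv⟩
    obtain ⟨f, hf, hfτ⟩ := hσ.exists_ratio hτ
    rcases hv with rfl | ⟨X, rfl⟩
    · rw [hfτ.eq_of_nhds]
      exact Submodule.smul_mem _ _ hs
    · change pd X τ w ∈ _
      rw [(pd_congr hfτ X).eq_of_nhds, pd_smul (hf.differentiableAt (by simp)) hσ.diff]
      refine add_mem (Submodule.smul_mem _ _ ?_) (Submodule.smul_mem _ _ hs)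
      rw [show pd X σ w = _ from fderiv_eq_pd σ w X]
      exact add_mem (Submodule.smul_mem _ _ h1) (Submodule.smul_mem _ _ h2)
  · refine Submodule.span_mono ?_
    rintro v (rfl | rfl | rfl)
    exacts [⟨σ, hσ, Or.inl rfl⟩, ⟨σ, hσ, Or.inr ⟨_, rfl⟩⟩, ⟨σ, hσ, Or.inr ⟨_, rfl⟩⟩]

/-- The central sphere in terms of one lift. -/
theorem centralSphere_eq (hσ : IsLiftAt L w σ) :
    centralSphere L w = Submodule.span ℝ {σ w, pd 1 σ w, pd Complex.I σ w,
      pd 1 (pd 1 σ) w + pd Complex.I (pd Complex.I σ) w} := by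
  rw [centralSphere, hσ.derived_eq]
  set S := Submodule.span ℝ {σ w, pd 1 σ w, pd Complex.I σ w,
      pd 1 (pd 1 σ) w + pd Complex.I (pd Complex.I σ) w} with hS
  have hs : σ w ∈ S := Submodule.subset_span (by simp)
  have h1 : pd 1 σ w ∈ S := Submodule.subset_span (by simp)
  have h2 : pd Complex.I σ w ∈ S := Submodule.subset_span (by simp)
  have h3 : pd 1 (pd 1 σ) w + pd Complex.I (pd Complex.I σ) w ∈ S :=
    Submodule.subset_span (by simp)
  apply le_antisymm
  · refine sup_le (Submodule.span_le.2 ?_) (Submodule.span_le.2 ?_)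
    · rintro v (rfl | rfl | rfl) <;> assumption
    · rintro v ⟨τ, hτ, rfl⟩
      obtain ⟨f, hf, hfτ⟩ := hσ.exists_ratio hτ
      have e : ∀ X, pd X (pd X τ) w = pd X (pd X fun y => f y • σ y) w :=
        fun X => (pd_congr (pd_congr hfτ X) X).eq_of_nhds
      rw [laplacian_eq_pd hτ.smooth, e, e, pd_pd_smul hf hσ.smooth, pd_pd_smul hf hσ.smooth]
      -- Both second derivatives of `σ` carry the same factor `f`, so only their sum, the Laplacian,
      -- occurs modulo `⟨σ, dσ⟩`.
      have : f w • pd 1 (pd 1 σ) w + (2 * pd 1 f w) • pd 1 σ w + pd 1 (pd 1 f) w • σ w +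
          (f w • pd Complex.I (pd Complex.I σ) w + (2 * pd Complex.I f w) • pd Complex.I σ w +
            pd Complex.I (pd Complex.I f) w • σ w) =
          f w • (pd 1 (pd 1 σ) w + pd Complex.I (pd Complex.I σ) w) +
          (2 * pd 1 f w) • pd 1 σ w + (2 * pd Complex.I f w) • pd Complex.I σ w +
          (pd 1 (pd 1 f) w + pd Complex.I (pd Complex.I f) w) • σ w := by module
      rw [this]
      exact add_mem (add_mem (add_mem (S.smul_mem _ h3) (S.smul_mem _ h1)) (S.smul_mem _ h2))
        (S.smul_mem _ hs)
  · refine Submodule.span_le.2 ?_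
    rintro v (rfl | rfl | rfl | rfl)
    · exact Submodule.mem_sup_left (Submodule.subset_span (by simp))
    · exact Submodule.mem_sup_left (Submodule.subset_span (by simp))
    · exact Submodule.mem_sup_left (Submodule.subset_span (by simp))
    · exact Submodule.mem_sup_right (Submodule.subset_span
        ⟨σ, hσ, (laplacian_eq_pd hσ.smooth).symm⟩)

end IsLiftAt

/-! ### Smoothness of the projection onto a frame -/

section Smooth

variable {w : ℂ} {s a b z : ℂ → Vec n}

theorem contDiffAt_inv_mink (ha : ContDiffAt ℝ ∞ a w) (h0 : mink n (a w) (a w) ≠ 0) :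
    ContDiffAt ℝ ∞ (fun y => (mink n (a y) (a y))⁻¹) w :=
  (contDiffAt_mink ha ha).inv h0

theorem contDiffAt_normalPart (ha : ContDiffAt ℝ ∞ a w) (hb : ContDiffAt ℝ ∞ b w)
    (hz : ContDiffAt ℝ ∞ z w) (h0 : mink n (a w) (a w) ≠ 0) :
    ContDiffAt ℝ ∞ (fun y => normalPart (a y) (b y) (z y)) w := by
  have hg := contDiffAt_inv_mink ha h0
  exact (hz.sub ((hg.mul (contDiffAt_mink ha hz)).smul ha)).sub
    ((hg.mul (contDiffAt_mink hb hz)).smul hb)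

theorem contDiffAt_nullPart (hs : ContDiffAt ℝ ∞ s w) (ha : ContDiffAt ℝ ∞ a w)
    (hb : ContDiffAt ℝ ∞ b w) (hz : ContDiffAt ℝ ∞ z w) (h0 : mink n (a w) (a w) ≠ 0) :
    ContDiffAt ℝ ∞ (fun y => nullPart (s y) (a y) (b y) (z y)) w := by
  have hn := contDiffAt_normalPart ha hb hz h0
  exact hn.add ((((contDiffAt_inv_mink ha h0).mul contDiffAt_const).mul
    (contDiffAt_mink hn hn)).smul hs)

theorem matSmoothAt_frameProj (hs : ContDiffAt ℝ ∞ s w) (ha : ContDiffAt ℝ ∞ a w)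
    (hb : ContDiffAt ℝ ∞ b w) (hz : ContDiffAt ℝ ∞ z w) (h0 : mink n (a w) (a w) ≠ 0) :
    MatSmoothAt (fun y => frameProj (s y) (a y) (b y) (z y)) w := fun i j => by
  have hN := contDiffAt_nullPart hs ha hb hz h0
  have h1 := matSmoothAt_dyad ha ha i j
  have h2 := matSmoothAt_dyad hb hb i j
  have h3 := matSmoothAt_dyad hs hN i j
  have h4 := matSmoothAt_dyad hN hs i j
  exact (contDiffAt_inv_mink ha h0).mul ((h1.add h2).sub (contDiffAt_const.mul (h3.add h4)))

end Smooth

/-! ### The frame of a conformal immersion -/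

section Frame

variable {U : Set ℂ} {L : ℂ → Submodule ℝ (Vec n)} {w : ℂ} {σ : ℂ → Vec n}

theorem pd_mink {u v : ℂ → Vec n} (X : ℂ) (hu : DifferentiableAt ℝ u w)
    (hv : DifferentiableAt ℝ v w) :
    pd X (fun y => mink n (u y) (v y)) w = mink n (pd X u w) (v w) + mink n (u w) (pd X v w) :=
  fderiv_mink hu hv X

theorem pd_of_eventually_zero {f : ℂ → ℝ} (h : ∀ᶠ y in 𝓝 w, f y = 0) (X : ℂ) : pd X f w = 0 := by
  have : f =ᶠ[𝓝 w] fun _ => 0 := h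
  rw [(pd_congr this X).eq_of_nhds]
  simp [pd]

/-- A lift with its coordinate derivatives and its Laplacian is a frame of the central sphere. -/
theorem IsSurfaceOn.isFrame (hU : IsOpen U) (hL : IsSurfaceOn U L) (hw : w ∈ U)
    (hσ : IsLiftAt L w σ) : IsFrame (σ w) (pd 1 σ w) (pd Complex.I σ w)
      (pd 1 (pd 1 σ) w + pd Complex.I (pd Complex.I σ) w) := by
  have hev : ∀ᶠ y in 𝓝 w, y ∈ U ∧ IsLiftAt L y σ := Filter.Eventually.and (hU.mem_nhds hw) hσ.eventually
  have hd : ∀ {y}, IsLiftAt L y σ → ∀ X, DifferentiableAt ℝ (pd X σ) y := fun h X =>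
    (contDiffAt_pd h.smooth X).differentiableAt (by simp)
  have hss : ∀ᶠ y in 𝓝 w, mink n (σ y) (σ y) = 0 :=
    hev.mono fun y hy => (hL y hy.1).2.1 _ hy.2.mem
  have hsX : ∀ X, ∀ᶠ y in 𝓝 w, mink n (σ y) (pd X σ y) = 0 := fun X => by
    filter_upwards [hev, eventually_eventually_nhds.2 hss] with y hy hy'
    have := pd_of_eventually_zero hy' X
    rw [pd_mink X hy.2.diff hy.2.diff, mink_comm] at this
    linarith
  -- Differentiates `(σ, σ_X) = 0`; adding the cases `X = 1` and `X = i` yields `(σ, Δσ) = -2 (σ_x,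
  -- σ_x)`.
  have hXX : ∀ X, mink n (pd X σ w) (pd X σ w) + mink n (σ w) (pd X (pd X σ) w) = 0 := fun X => by
    rw [← pd_mink X hσ.diff (hd hσ X)]
    exact pd_of_eventually_zero (hsX X) X
  have hconf := (hL w hw).2.2.2 σ hσ
  have hbb : mink n (pd Complex.I σ w) (pd Complex.I σ w) = mink n (pd 1 σ w) (pd 1 σ w) := by
    have := hconf 1 1
    rwa [mul_one] at this
  have hab : mink n (pd 1 σ w) (pd Complex.I σ w) = 0 := by
    have := hconf 1 Complex.I
    rw [mul_one, Complex.I_mul_I, map_neg, map_neg] at this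
    change -mink n (pd Complex.I σ w) (pd 1 σ w) = mink n (pd 1 σ w) (pd Complex.I σ w) at this
    rw [mink_comm] at this
    linarith
  refine ⟨hss.self_of_nhds, (hsX 1).self_of_nhds, (hsX _).self_of_nhds, hab, hbb, ?_, fun h0 => ?_⟩
  · have h1 := hXX 1
    have h2 := hXX Complex.I
    rw [map_add]
    linarith
  -- A null `σ_x`, being orthogonal to `σ`, would be a multiple of it, and `L^{(1)}` would have rank
  -- at most 2.
  · obtain ⟨c, hc⟩ := exists_smul_eq_of_null hss.self_of_nhds h0 (hsX 1).self_of_nhds hσ.ne_zero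
    have hr := (hL w hw).2.2.1
    rw [hσ.derived_eq] at hr
    have : Submodule.span ℝ {σ w, pd 1 σ w, pd Complex.I σ w} ≤
        Submodule.span ℝ (({σ w, pd Complex.I σ w} : Finset (Vec n)) : Set (Vec n)) := by
      refine Submodule.span_le.2 ?_
      rintro v (rfl | rfl | rfl)
      · exact Submodule.subset_span (by simp)
      · rw [hc]
        exact Submodule.smul_mem _ _ (Submodule.subset_span (by simp))
      · exact Submodule.subset_span (by simp)
    have h1 := Submodule.finrank_mono this
    have h2 := finrank_span_finset_le_card (R := ℝ) ({σ w, pd Complex.I σ w} : Finset (Vec n))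
    have h3 : ({σ w, pd Complex.I σ w} : Finset (Vec n)).card ≤ 2 := Finset.card_le_two
    rw [Set.finrank] at h2
    omega

theorem IsSurfaceOn.projS_eq (hU : IsOpen U) (hL : IsSurfaceOn U L) (hw : w ∈ U)
    (hσ : IsLiftAt L w σ) : projS L w = frameProj (σ w) (pd 1 σ w) (pd Complex.I σ w)
      (pd 1 (pd 1 σ) w + pd Complex.I (pd Complex.I σ) w) := by
  rw [projS, hσ.centralSphere_eq]
  exact (hL.isFrame hU hw hσ).orthProj_span

theorem IsSurfaceOn.projS_smooth (hU : IsOpen U) (hL : IsSurfaceOn U L) (hw : w ∈ U) :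
    MatSmoothAt (projS L) w := by
  obtain ⟨σ, hσ⟩ := (hL w hw).1
  have h : projS L =ᶠ[𝓝 w] fun y => frameProj (σ y) (pd 1 σ y) (pd Complex.I σ y)
      (pd 1 (pd 1 σ) y + pd Complex.I (pd Complex.I σ) y) := by
    filter_upwards [hU.mem_nhds hw, hσ.eventually] with y h1 h2 using hL.projS_eq hU h1 h2
  refine MatSmoothAt.congr ?_ h
  have ha := contDiffAt_pd hσ.smooth 1
  have hb := contDiffAt_pd hσ.smooth Complex.I
  exact matSmoothAt_frameProj hσ.smooth ha hb
    ((contDiffAt_pd ha 1).add (contDiffAt_pd hb Complex.I)) (hL.isFrame hU hw hσ).aa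

end Frame

/-! ### Derivatives of families of projections -/

section Projections

variable {P A : ℂ → Mat n} {w : ℂ}

theorem dMat_eq_of_idempotent (hP : MatDiffAt P w) (hPP : ∀ᶠ y in 𝓝 w, P y * P y = P y) (X : ℂ) :
    dMat P w X = dMat P w X * P w + P w * dMat P w X := by
  have h : (fun y => P y * P y) =ᶠ[𝓝 w] P := hPP
  rw [← dMat_mul hP hP, dMat_congr h]

/-- Multiplying `dP = dP P + P dP` by `P` on the left shows that `dP` is off-diagonal on the image
of `P`. -/
theorem proj_mul_dMat_mul_proj (hP : MatDiffAt P w) (hPP : ∀ᶠ y in 𝓝 w, P y * P y = P y) (X : ℂ) :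
    P w * dMat P w X * P w = 0 := by
  have h := congrArg (P w * ·) (dMat_eq_of_idempotent hP hPP X)
  simp only [mul_add] at h
  rw [← mul_assoc (P w) (P w), hPP.self_of_nhds] at h
  rw [mul_assoc]
  exact right_eq_add.1 h

theorem formN_eq_commutator (hP : MatDiffAt P w) (hPP : ∀ᶠ y in 𝓝 w, P y * P y = P y) (X : ℂ) :
    formN P w X = dMat P w X * P w - P w * dMat P w X := by
  have h1 : formN P w X = -(P w * dMat P w X + (1 - P w) * dMat (fun y => 1 - P y) w X) := rfl
  have h := dMat_eq_of_idempotent hP hPP X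
  rw [h1, dMat_const_sub, LinearMap.neg_apply, eq_sub_iff_add_eq]
  conv_rhs => rw [eq_sub_iff_add_eq.2 h.symm]
  noncomm_ring

/-- `𝒩` acts on endomorphisms supported on the image of `P`. -/
theorem lie_formN (hP : MatDiffAt P w) (hPP : ∀ᶠ y in 𝓝 w, P y * P y = P y) {B : Mat n}
    (hPB : P w * B = B) (hBP : B * P w = B) (X : ℂ) :
    ⁅formN P w X, B⁆ = dMat P w X * B + B * dMat P w X := by
  have h := proj_mul_dMat_mul_proj hP hPP X
  rw [Ring.lie_def, formN_eq_commutator hP hPP]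
  have h1 : P w * dMat P w X * B = 0 := by rw [← hPB, ← mul_assoc, h, zero_mul]
  have h2 : B * (dMat P w X * P w) = 0 := by
    rw [← hBP, mul_assoc, ← mul_assoc (P w), h, mul_zero]
  rw [sub_mul, mul_sub, h1, h2, mul_assoc, hPB, ← mul_assoc B, hBP]
  abel

/-- Leibniz for `PA = A`. With `dMat_mul_compl` and `lie_formN` it gives `[𝒩, A] = (1 - P) dA + dA
(1 - P)` when `A = PA = AP`, so brackets with `𝒩` can be read off from `dA`. -/
theorem compl_mul_dMat (hP : MatDiffAt P w) (hA : MatDiffAt A w)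
    (hPA : ∀ᶠ y in 𝓝 w, P y * A y = A y) (X : ℂ) :
    (1 - P w) * dMat A w X = dMat P w X * A w := by
  have h : (fun y => P y * A y) =ᶠ[𝓝 w] A := hPA
  have h1 := dMat_mul hP hA X
  rw [dMat_congr h] at h1
  rw [sub_mul, one_mul, sub_eq_iff_eq_add]
  exact h1

theorem dMat_mul_compl (hP : MatDiffAt P w) (hA : MatDiffAt A w)
    (hAP : ∀ᶠ y in 𝓝 w, A y * P y = A y) (X : ℂ) :
    dMat A w X * (1 - P w) = A w * dMat P w X := by
  have h : (fun y => A y * P y) =ᶠ[𝓝 w] A := hAP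
  have h1 := dMat_mul hA hP X
  rw [dMat_congr h] at h1
  rw [mul_sub, mul_one, sub_eq_iff_eq_add]
  exact h1.trans (add_comm _ _)

end Projections

/-! ### Frames -/

namespace IsFrame

variable {s a b z : Vec n}

/-- Coordinates of an element of `⟨s⟩ ∧ ⟨s, a, b⟩`. -/
theorem eq_wedge (h : IsFrame s a b z) {T : Mat n}
    (hT : T ∈ wedgeSpan (Submodule.span ℝ {s}) (Submodule.span ℝ {s, a, b})) :
    T = wedge s ((mink n (T *ᵥ a) z * ((mink n a a)⁻¹ * (mink n a a)⁻¹ * (1 / 2))) • a +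
      (mink n (T *ᵥ b) z * ((mink n a a)⁻¹ * (mink n a a)⁻¹ * (1 / 2))) • b) := by
  have h0 := h.aa
  obtain ⟨v, hv, rfl⟩ := mem_wedgeSpan_span_singleton hT
  obtain ⟨k, u, hu, rfl⟩ := Submodule.mem_span_insert.1 hv
  obtain ⟨x, y, rfl⟩ := Submodule.mem_span_pair.1 hu
  have e1 : wedge s (k • s + (x • a + y • b)) = wedge s (x • a + y • b) := by
    rw [wedge_add_right, wedge_smul_right, wedge_self, smul_zero, zero_add]
  rw [e1]
  -- The endomorphism sends `a` to `-x (a, a) s`, and `(s, z) = -2 (a, a)`; the coefficient is thus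
  -- a smooth expression in `T` and the frame.
  have e2 : mink n (wedge s (x • a + y • b) *ᵥ a) z = 2 * mink n a a * mink n a a * x := by
    simp only [wedge_mulVec, map_add, map_sub, map_smul, LinearMap.add_apply, LinearMap.sub_apply,
      LinearMap.smul_apply, smul_eq_mul, h.sa, mink_comm b a, h.ab, h.sz]
    ring
  have e3 : mink n (wedge s (x • a + y • b) *ᵥ b) z = 2 * mink n a a * mink n a a * y := by
    simp only [wedge_mulVec, map_add, map_sub, map_smul, LinearMap.add_apply, LinearMap.sub_apply,
      LinearMap.smul_apply, smul_eq_mul, h.sb, h.bb, h.ab, h.sz]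
    ring
  rw [e2, e3]
  congr 3 <;> field_simp

/-- Pairing the image of `a` with `b` isolates `c`. Then `s ∧ W = 0` applied to `z`, with `(s, z) ≠
0`, puts `W` in `⟨s⟩`, which is orthogonal to `s`, `a`, `b`. -/
theorem eq_zero_of_wedge_add (h : IsFrame s a b z) {c : ℝ} {W : Vec n}
    (hW : c • wedge a b + wedge s W = 0) :
    c = 0 ∧ mink n s W = 0 ∧ mink n a W = 0 ∧ mink n b W = 0 := by
  have h0 := h.aa
  have hc : c = 0 := by
    have := congrArg (fun T : Mat n => mink n (T *ᵥ a) b) hW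
    simp only [add_mulVec, smul_mulVec, wedge_mulVec, map_add, map_sub, map_smul,
      LinearMap.add_apply, LinearMap.sub_apply, LinearMap.smul_apply, smul_eq_mul, h.sa, h.sb,
      h.bb, h.ab, zero_mulVec, map_zero, LinearMap.zero_apply] at this
    simpa [h0] using this
  subst hc
  rw [zero_smul, zero_add] at hW
  have h1 := congrArg (fun T : Mat n => T *ᵥ z) hW
  simp only [wedge_mulVec, h.sz, zero_mulVec] at h1
  have h2 : ∀ x, mink n x s = 0 → mink n x W = 0 := fun x hx => by
    have := congrArg (mink n x) h1
    simpa [hx, h0] using this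
  exact ⟨rfl, h2 _ h.ss, h2 _ (by rw [mink_comm, h.sa]), h2 _ (by rw [mink_comm, h.sb])⟩

theorem proj_mul_wedge (h : IsFrame s a b z) {v : Vec n}
    (hv : v ∈ Submodule.span ℝ {s, a, b, z}) :
    frameProj s a b z * wedge s v = wedge s v := mat_ext fun x => by
  rw [← mulVec_mulVec, wedge_mulVec, mulVec_sub, mulVec_smul, mulVec_smul, h.proj_of_mem hv,
    h.proj_s]

theorem wedge_mul_proj (h : IsFrame s a b z) {v : Vec n}
    (hv : v ∈ Submodule.span ℝ {s, a, b, z}) :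
    wedge s v * frameProj s a b z = wedge s v := mat_ext fun x => by
  rw [← mulVec_mulVec, wedge_mulVec, wedge_mulVec, ← frameProj_selfAdjoint,
    ← frameProj_selfAdjoint, h.proj_of_mem hv, h.proj_s]

/-- The compression is `s ∧ PV`, and `PV` is a multiple of `s`. -/
theorem proj_mul_wedge_mul_proj (h : IsFrame s a b z) {V : Vec n} (hs : mink n s V = 0)
    (ha : mink n a V = 0) (hb : mink n b V = 0) :
    frameProj s a b z * wedge s V * frameProj s a b z = 0 := mat_ext fun x => by
  obtain ⟨c, hc⟩ := proj_of_orthogonal (z := z) hs ha hb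
  rw [← mulVec_mulVec, ← mulVec_mulVec, wedge_mulVec, mulVec_sub, mulVec_smul, mulVec_smul,
    ← frameProj_selfAdjoint, ← frameProj_selfAdjoint, h.proj_s, hc, zero_mulVec]
  simp only [map_smul, LinearMap.smul_apply, smul_eq_mul]
  module

end IsFrame

/-! ### Derivatives of the frame of a conformal immersion -/

section Surface

variable {U : Set ℂ} {L : ℂ → Submodule ℝ (Vec n)} {w : ℂ} {σ : ℂ → Vec n}

/-- Derivatives of the frame's Gram relations, which hold on a neighbourhood. -/
theorem IsSurfaceOn.frame_relations (hU : IsOpen U) (hL : IsSurfaceOn U L) (hw : w ∈ U)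
    (hσ : IsLiftAt L w σ) (X : ℂ) :
    mink n (pd X σ w) (pd 1 σ w) + mink n (σ w) (pd X (pd 1 σ) w) = 0 ∧
    mink n (pd X σ w) (pd Complex.I σ w) + mink n (σ w) (pd X (pd Complex.I σ) w) = 0 ∧
    mink n (pd X (pd 1 σ) w) (pd Complex.I σ w) +
      mink n (pd 1 σ w) (pd X (pd Complex.I σ) w) = 0 ∧
    mink n (pd Complex.I σ w) (pd X (pd Complex.I σ) w) =
      mink n (pd 1 σ w) (pd X (pd 1 σ) w) := by
  have hev : ∀ᶠ y in 𝓝 w, IsFrame (σ y) (pd 1 σ y) (pd Complex.I σ y)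
      (pd 1 (pd 1 σ) y + pd Complex.I (pd Complex.I σ) y) := by
    filter_upwards [hU.mem_nhds hw, hσ.eventually] with y h1 h2 using hL.isFrame hU h1 h2
  have hd : ∀ Y, DifferentiableAt ℝ (pd Y σ) w := fun Y =>
    (contDiffAt_pd hσ.smooth Y).differentiableAt (by simp)
  refine ⟨?_, ?_, ?_, ?_⟩
  · rw [← pd_mink X hσ.diff (hd 1)]
    exact pd_of_eventually_zero (hev.mono fun y hy => hy.sa) X
  · rw [← pd_mink X hσ.diff (hd _)]
    exact pd_of_eventually_zero (hev.mono fun y hy => hy.sb) X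
  · rw [← pd_mink X (hd 1) (hd _)]
    exact pd_of_eventually_zero (hev.mono fun y hy => hy.ab) X
  · have h : (fun y => mink n (pd Complex.I σ y) (pd Complex.I σ y)) =ᶠ[𝓝 w]
        fun y => mink n (pd 1 σ y) (pd 1 σ y) := hev.mono fun y hy => hy.bb
    have := (pd_congr h X).eq_of_nhds
    rw [pd_mink X (hd _) (hd _), pd_mink X (hd _) (hd _), mink_comm (pd X _ w),
      mink_comm (pd X _ w)] at this
    linarith

theorem dMat_wedge_frame {f g : ℂ → ℝ} (hσ : ContDiffAt ℝ ∞ σ w) (hf : ContDiffAt ℝ ∞ f w)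
    (hg : ContDiffAt ℝ ∞ g w) (X : ℂ) :
    dMat (fun y => wedge (σ y) (f y • pd 1 σ y + g y • pd Complex.I σ y)) w X =
      wedge (pd X σ w) (f w • pd 1 σ w + g w • pd Complex.I σ w) +
      wedge (σ w) (pd X f w • pd 1 σ w + f w • pd X (pd 1 σ) w +
        (pd X g w • pd Complex.I σ w + g w • pd X (pd Complex.I σ) w)) := by
  have hσ' := hσ.differentiableAt (by simp)
  have hf' := hf.differentiableAt (by simp)
  have hg' := hg.differentiableAt (by simp)
  have hd : ∀ Y, DifferentiableAt ℝ (pd Y σ) w := fun Y =>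
    (contDiffAt_pd hσ Y).differentiableAt (by simp)
  rw [dMat_wedge hσ' ((hf'.fun_smul (hd _)).fun_add (hg'.fun_smul (hd _))),
    fderiv_fun_add (hf'.fun_smul (hd _)) (hg'.fun_smul (hd _)), _root_.add_apply]
  have h1 := pd_smul hf' (hd 1) X
  have h2 := pd_smul hg' (hd Complex.I) X
  rw [pd] at h1 h2
  rw [h1, h2, add_comm (f w • pd X _ w), add_comm (g w • pd X _ w)]
  rfl

/-- The coefficients of a closed form with values in `L ∧ L^{(1)}` are symmetric and trace-free. -/
theorem IsSurfaceOn.coeff_relations (hU : IsOpen U) (hL : IsSurfaceOn U L) (hw : w ∈ U)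
    (hσ : IsLiftAt L w σ) {f₁ g₁ f₂ g₂ : ℂ → ℝ} (hf₁ : ContDiffAt ℝ ∞ f₁ w)
    (hg₁ : ContDiffAt ℝ ∞ g₁ w) (hf₂ : ContDiffAt ℝ ∞ f₂ w) (hg₂ : ContDiffAt ℝ ∞ g₂ w)
    (hd : dMat (fun y => wedge (σ y) (f₂ y • pd 1 σ y + g₂ y • pd Complex.I σ y)) w 1 =
      dMat (fun y => wedge (σ y) (f₁ y • pd 1 σ y + g₁ y • pd Complex.I σ y)) w Complex.I) :
    (f₁ w + g₂ w = 0 ∧ g₁ w = f₂ w) ∧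
    f₂ w * mink n (pd 1 σ w) (pd 1 (pd 1 σ) w) + pd 1 f₂ w * mink n (pd 1 σ w) (pd 1 σ w)
      + g₂ w * mink n (pd 1 σ w) (pd 1 (pd Complex.I σ) w)
      = f₁ w * mink n (pd 1 σ w) (pd Complex.I (pd 1 σ) w)
        + pd Complex.I f₁ w * mink n (pd 1 σ w) (pd 1 σ w)
        + g₁ w * mink n (pd 1 σ w) (pd Complex.I (pd Complex.I σ) w) ∧
    f₂ w * mink n (pd Complex.I σ w) (pd 1 (pd 1 σ) w)
      + pd 1 g₂ w * mink n (pd 1 σ w) (pd 1 σ w)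
      + g₂ w * mink n (pd Complex.I σ w) (pd 1 (pd Complex.I σ) w)
      = f₁ w * mink n (pd Complex.I σ w) (pd Complex.I (pd 1 σ) w)
        + pd Complex.I g₁ w * mink n (pd 1 σ w) (pd 1 σ w)
        + g₁ w * mink n (pd Complex.I σ w) (pd Complex.I (pd Complex.I σ) w) := by
  have hF := hL.isFrame hU hw hσ
  have h0 := hF.aa
  rw [dMat_wedge_frame hσ.smooth hf₁ hg₁, dMat_wedge_frame hσ.smooth hf₂ hg₂] at hd
  -- The curl splits into a `σ_x ∧ σ_y` part, whose coefficient is the trace, and a part `σ ∧ W`.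
  -- Pairing `W` with `σ` gives symmetry; pairing it with `σ_x`, `σ_y` gives the two differential
  -- equations.
  have hW : (f₁ w + g₂ w) • wedge (pd 1 σ w) (pd Complex.I σ w) + wedge (σ w)
      ((pd 1 f₂ w • pd 1 σ w + f₂ w • pd 1 (pd 1 σ) w +
        (pd 1 g₂ w • pd Complex.I σ w + g₂ w • pd 1 (pd Complex.I σ) w)) +
      (-1 : ℝ) • (pd Complex.I f₁ w • pd 1 σ w + f₁ w • pd Complex.I (pd 1 σ) w +
        (pd Complex.I g₁ w • pd Complex.I σ w + g₁ w • pd Complex.I (pd Complex.I σ) w))) = 0 := by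
    rw [wedge_add_right (σ w), wedge_smul_right _ (σ w)]
    rw [← sub_eq_zero] at hd
    rw [← hd]
    simp only [wedge_add_right (pd _ σ w), wedge_smul_right _ (pd _ σ w), wedge_self,
      wedge_comm (pd Complex.I σ w) (pd 1 σ w)]
    module
  obtain ⟨h1, hs, ha, hb⟩ := hF.eq_zero_of_wedge_add hW
  obtain ⟨r1, r2, -, -⟩ := hL.frame_relations hU hw hσ 1
  obtain ⟨r5, r6, -, -⟩ := hL.frame_relations hU hw hσ Complex.I
  simp only [map_add, map_smul, smul_eq_mul, hF.sa, hF.sb] at hs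
  simp only [map_add, map_smul, smul_eq_mul, hF.ab] at ha
  simp only [map_add, map_smul, smul_eq_mul, hF.bb, mink_comm (pd Complex.I σ w) (pd 1 σ w),
    hF.ab] at hb
  rw [hF.ab] at r2
  rw [mink_comm, hF.ab] at r5
  rw [hF.bb] at r6
  refine ⟨⟨h1, ?_⟩, by linarith, by linarith⟩
  have e1 := eq_neg_of_add_eq_zero_right r1
  have e2 := eq_neg_of_add_eq_zero_right r2
  have e5 := eq_neg_of_add_eq_zero_right r5
  have e6 := eq_neg_of_add_eq_zero_right r6
  rw [e1, e2, e5, e6] at hs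
  have : (g₁ w - f₂ w) * mink n (pd 1 σ w) (pd 1 σ w) = 0 := by linarith
  linarith [(mul_eq_zero.1 this).resolve_right h0]

/-- The coefficients of a section of `L ∧ L^{(1)}`. -/
theorem IsSurfaceOn.exists_coeff (hU : IsOpen U) (hL : IsSurfaceOn U L) (hw : w ∈ U)
    (hσ : IsLiftAt L w σ) {A : ℂ → Mat n} (hA : ∀ y ∈ U, MatSmoothAt A y)
    (hAL : ∀ y ∈ U, A y ∈ wedgeSpan (L y) (derived L y)) :
    ∃ f g : ℂ → ℝ, (∀ᶠ y in 𝓝 w, ContDiffAt ℝ ∞ f y ∧ ContDiffAt ℝ ∞ g y) ∧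
      A =ᶠ[𝓝 w] fun y => wedge (σ y) (f y • pd 1 σ y + g y • pd Complex.I σ y) := by
  have hev : ∀ᶠ y in 𝓝 w, y ∈ U ∧ IsLiftAt L y σ :=
    Filter.Eventually.and (hU.mem_nhds hw) hσ.eventually
  -- These are the coefficients of `IsFrame.eq_wedge`; the explicit formula makes them smooth.
  let c : (ℂ → Vec n) → ℂ → ℝ := fun v y =>
    mink n (A y *ᵥ v y) (pd 1 (pd 1 σ) y + pd Complex.I (pd Complex.I σ) y) *
      ((mink n (pd 1 σ y) (pd 1 σ y))⁻¹ * (mink n (pd 1 σ y) (pd 1 σ y))⁻¹ * (1 / 2))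
  refine ⟨c (pd 1 σ), c (pd Complex.I σ), ?_, ?_⟩
  · filter_upwards [hev] with y hy
    have hd := contDiffAt_pd hy.2.smooth
    have hg := contDiffAt_inv_mink (hd 1) (hL.isFrame hU hy.1 hy.2).aa
    have : ∀ X, ContDiffAt ℝ ∞ (c (pd X σ)) y := fun X =>
      (contDiffAt_mink ((hA y hy.1).mulVec (hd X))
        ((contDiffAt_pd (hd 1) 1).add (contDiffAt_pd (hd Complex.I) Complex.I))).mul
        ((hg.mul hg).mul contDiffAt_const)
    exact ⟨this _, this _⟩
  · filter_upwards [hev] with y hy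
    have h := hAL y hy.1
    rw [hy.2.span_eq, hy.2.derived_eq] at h
    exact (hL.isFrame hU hy.1 hy.2).eq_wedge h

/-- The divergence of the coefficients of a closed form with values in `L ∧ L^{(1)}` has no
component in the central sphere. -/
theorem IsSurfaceOn.proj_divergence (hU : IsOpen U) (hL : IsSurfaceOn U L) (hw : w ∈ U)
    {A B : ℂ → Mat n} (hA : ∀ y ∈ U, MatSmoothAt A y) (hB : ∀ y ∈ U, MatSmoothAt B y)
    (hAL : ∀ y ∈ U, A y ∈ wedgeSpan (L y) (derived L y))
    (hBL : ∀ y ∈ U, B y ∈ wedgeSpan (L y) (derived L y))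
    (hd : ∀ y ∈ U, dMat B y 1 = dMat A y Complex.I) :
    projS L w * (dMat A w 1 + dMat B w Complex.I) * projS L w = 0 := by
  obtain ⟨σ, hσ⟩ := (hL w hw).1
  obtain ⟨f₁, g₁, hs₁, hA'⟩ := hL.exists_coeff hU hw hσ hA hAL
  obtain ⟨f₂, g₂, hs₂, hB'⟩ := hL.exists_coeff hU hw hσ hB hBL
  -- Needed near `w`, not only at `w`, since these relations are differentiated in `c3` and `c4`.
  have hrel : ∀ᶠ y in 𝓝 w, f₁ y + g₂ y = 0 ∧ g₁ y = f₂ y := by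
    filter_upwards [hU.mem_nhds hw, hσ.eventually, hs₁, hs₂, hA'.eventually_nhds,
      hB'.eventually_nhds] with y hy h1 h2 h3 h4 h5
    have h := hd y hy
    rw [dMat_congr h4, dMat_congr h5] at h
    exact (hL.coeff_relations hU hy h1 h2.1 h2.2 h3.1 h3.2 h).1
  have h := hd w hw
  rw [dMat_congr hA', dMat_congr hB'] at h
  obtain ⟨hf₁, hg₁⟩ := hs₁.self_of_nhds
  obtain ⟨hf₂, hg₂⟩ := hs₂.self_of_nhds
  obtain ⟨⟨c1, c2⟩, ca, cb⟩ := hL.coeff_relations hU hw hσ hf₁ hg₁ hf₂ hg₂ h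
  have hF := hL.isFrame hU hw hσ
  have c3 : ∀ X, pd X g₂ w = -pd X f₁ w := fun X => by
    have e : g₂ =ᶠ[𝓝 w] fun y => -f₁ y := hrel.mono fun y hy => by linarith [hy.1]
    rw [(pd_congr e X).eq_of_nhds, pd, pd, fderiv_fun_neg]
    rfl
  have c4 : ∀ X, pd X g₁ w = pd X f₂ w := fun X => by
    have e : g₁ =ᶠ[𝓝 w] f₂ := hrel.mono fun y hy => hy.2
    exact (pd_congr e X).eq_of_nhds
  have c5 : g₂ w = -f₁ w := by linarith
  have hcomm := pd_comm hσ.smooth Complex.I 1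
  rw [hL.projS_eq hU hw hσ, dMat_congr hA', dMat_congr hB', dMat_wedge_frame hσ.smooth hf₁ hg₁,
    dMat_wedge_frame hσ.smooth hf₂ hg₂]
  -- The `σ_x ∧ σ_y` part of the divergence is the antisymmetric part of the coefficients, which
  -- vanishes.
  have e : wedge (pd 1 σ w) (f₁ w • pd 1 σ w + g₁ w • pd Complex.I σ w) +
      wedge (pd Complex.I σ w) (f₂ w • pd 1 σ w + g₂ w • pd Complex.I σ w) = 0 := by
    simp only [wedge_add_right, wedge_smul_right, wedge_self,
      wedge_comm (pd Complex.I σ w) (pd 1 σ w), c2]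
    module
  rw [add_add_add_comm, e, zero_add, ← wedge_add_right]
  obtain ⟨r1, r2, r3, r4⟩ := hL.frame_relations hU hw hσ 1
  obtain ⟨r5, r6, r7, r8⟩ := hL.frame_relations hU hw hσ Complex.I
  rw [hF.ab] at r2
  rw [mink_comm, hF.ab] at r5
  rw [hF.bb] at r6
  rw [mink_comm] at r3 r7
  simp only [hcomm, c2, c3, c4, c5] at *
  have e1 := eq_neg_of_add_eq_zero_right r1
  have e2 := eq_neg_of_add_eq_zero_right r2
  have e6 := eq_neg_of_add_eq_zero_right r6
  -- Modulo the frame relations, the products of the divergence vector with `σ_x` and `σ_y` are a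
  -- quarter turn of those of the curl: the former uses `-cb`, the latter `ca`.
  refine hF.proj_mul_wedge_mul_proj ?_ ?_ ?_
  · simp only [map_add, map_smul, smul_eq_mul, hF.sa, hF.sb, e1, e2, e6]
    ring
  · simp only [map_add, map_smul, smul_eq_mul, hF.ab]
    linear_combination -cb - f₁ w * r4 + f₂ w * r3 - f₂ w * r8 - f₁ w * r7
  · simp only [map_add, map_smul, smul_eq_mul, hF.bb, mink_comm (pd Complex.I σ w) (pd 1 σ w),
      hF.ab]
    linear_combination ca + f₁ w * r3 - f₁ w * r8 + f₂ w * r7 + f₂ w * r4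

end Surface

/-! ### Tangential forms -/

section Tangential

variable {U : Set ℂ} {L : ℂ → Submodule ℝ (Vec n)} {w : ℂ} {σ : ℂ → Vec n} {α β : LForm n}

theorem IsTangentialOn.smooth (hU : IsOpen U) (hα : IsTangentialOn U L α) (hw : w ∈ U) (X : ℂ) :
    MatSmoothAt (fun y => α y X) w :=
  fun i j => (hα.1 X i j).contDiffAt (hU.mem_nhds hw)

theorem IsTangentialOn.exists_wedge (hα : IsTangentialOn U L α) (hw : w ∈ U)
    (hσ : IsLiftAt L w σ) (X : ℂ) :
    ∃ v ∈ Submodule.span ℝ {σ w, pd 1 σ w, pd Complex.I σ w}, α w X = wedge (σ w) v := by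
  have h := hα.2 w hw X
  rw [hσ.span_eq, hσ.derived_eq] at h
  exact mem_wedgeSpan_span_singleton h

theorem IsFrame.mink_eq_zero {s a b z v : Vec n} (h : IsFrame s a b z)
    (hv : v ∈ Submodule.span ℝ {s, a, b}) : mink n s v = 0 := by
  induction hv using Submodule.span_induction with
  | mem v hv =>
    rcases hv with rfl | rfl | rfl
    exacts [h.ss, h.sa, h.sb]
  | zero => simp
  | add u v _ _ hu hv => rw [map_add, hu, hv, add_zero]
  | smul c v _ hv => rw [map_smul, hv, smul_zero]

theorem IsSurfaceOn.proj_idempotent (hU : IsOpen U) (hL : IsSurfaceOn U L) (hw : w ∈ U) :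
    projS L w * projS L w = projS L w := by
  obtain ⟨σ, hσ⟩ := (hL w hw).1
  rw [hL.projS_eq hU hw hσ]
  exact (hL.isFrame hU hw hσ).proj_mul_self

theorem IsSurfaceOn.eventually_proj_idempotent (hU : IsOpen U) (hL : IsSurfaceOn U L)
    (hw : w ∈ U) : ∀ᶠ y in 𝓝 w, projS L y * projS L y = projS L y :=
  Filter.Eventually.mono (hU.mem_nhds hw) fun _ hy => hL.proj_idempotent hU hy

theorem IsSurfaceOn.proj_mul (hU : IsOpen U) (hL : IsSurfaceOn U L) (hα : IsTangentialOn U L α)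
    (hw : w ∈ U) (X : ℂ) : projS L w * α w X = α w X := by
  obtain ⟨σ, hσ⟩ := (hL w hw).1
  obtain ⟨v, hv, h⟩ := hα.exists_wedge hw hσ X
  rw [hL.projS_eq hU hw hσ, h]
  exact (hL.isFrame hU hw hσ).proj_mul_wedge (Submodule.span_mono (by grind) hv)

theorem IsSurfaceOn.mul_proj (hU : IsOpen U) (hL : IsSurfaceOn U L) (hα : IsTangentialOn U L α)
    (hw : w ∈ U) (X : ℂ) : α w X * projS L w = α w X := by
  obtain ⟨σ, hσ⟩ := (hL w hw).1
  obtain ⟨v, hv, h⟩ := hα.exists_wedge hw hσ X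
  rw [hL.projS_eq hU hw hσ, h]
  exact (hL.isFrame hU hw hσ).wedge_mul_proj (Submodule.span_mono (by grind) hv)

/-- The bundle `L ∧ L^{(1)}` is abelian. -/
theorem IsSurfaceOn.lie_eq_zero (hU : IsOpen U) (hL : IsSurfaceOn U L) (hα : IsTangentialOn U L α)
    (hβ : IsTangentialOn U L β) (hw : w ∈ U) (X Y : ℂ) : ⁅α w X, β w Y⁆ = 0 := by
  obtain ⟨σ, hσ⟩ := (hL w hw).1
  obtain ⟨u, hu, h⟩ := hα.exists_wedge hw hσ X
  obtain ⟨v, hv, h'⟩ := hβ.exists_wedge hw hσ Y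
  have hF := hL.isFrame hU hw hσ
  rw [h, h', Ring.lie_def, wedge_mul_wedge_comm hF.ss (hF.mink_eq_zero hu) (hF.mink_eq_zero hv),
    sub_self]

theorem IsSurfaceOn.tangential_mulVec (hU : IsOpen U) (hL : IsSurfaceOn U L)
    (hα : IsTangentialOn U L α) (hw : w ∈ U) (hσ : IsLiftAt L w σ) (X : ℂ) :
    α w X *ᵥ σ w = 0 := by
  obtain ⟨v, hv, h⟩ := hα.exists_wedge hw hσ X
  have hF := hL.isFrame hU hw hσ
  rw [h, wedge_mulVec, hF.ss, mink_comm, hF.mink_eq_zero hv, zero_smul, zero_smul, sub_zero]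

/-- Both `σ` and `dσ` lie in `S`; differentiating `Pσ = σ` then gives `dP σ = 0`. -/
theorem IsSurfaceOn.formN_mulVec (hU : IsOpen U) (hL : IsSurfaceOn U L) (hw : w ∈ U)
    (hσ : IsLiftAt L w σ) (X : ℂ) : formN (projS L) w X *ᵥ σ w = 0 := by
  have hP := (hL.projS_smooth hU hw).diff
  have h : (fun y => projS L y *ᵥ σ y) =ᶠ[𝓝 w] σ := by
    filter_upwards [hU.mem_nhds hw, hσ.eventually] with y h1 h2
    rw [hL.projS_eq hU h1 h2]
    exact (hL.isFrame hU h1 h2).proj_s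
  have h1 := fderiv_mulVec_apply hP hσ.diff X
  have h2 : projS L w *ᵥ fderiv ℝ σ w X = fderiv ℝ σ w X := by
    have hF := hL.isFrame hU hw hσ
    rw [hL.projS_eq hU hw hσ, fderiv_eq_pd, mulVec_add, mulVec_smul, mulVec_smul, hF.proj_a,
      hF.proj_b]
  rw [h.fderiv_eq, h2] at h1
  have h3 := right_eq_add.1 h1
  rw [formN_eq_commutator hP (hL.eventually_proj_idempotent hU hw), sub_mulVec, ← mulVec_mulVec,
    ← mulVec_mulVec, h.eq_of_nhds, h3, mulVec_zero, sub_zero]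

/-! ### Closed tangential forms, their Hodge duals and rotations -/

theorem LForm.apply_eq (α : LForm n) (y X : ℂ) :
    α y X = X.re • α y 1 + X.im • α y Complex.I := by
  conv_lhs => rw [← Complex.re_add_im X]
  rw [show (X.re : ℂ) + X.im * Complex.I = X.re • (1 : ℂ) + X.im • Complex.I by simp,
    map_add, map_smul, map_smul]

theorem dMat_apply_eq (A : ℂ → Mat n) (y X : ℂ) :
    dMat A y X = X.re • dMat A y 1 + X.im • dMat A y Complex.I :=
  LForm.apply_eq (dMat A) y X

theorem dMat_form (hα : ∀ X, MatDiffAt (fun y => α y X) w) (X Y : ℂ) :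
    dMat (fun y => α y Y) w X =
      Y.re • dMat (fun y => α y 1) w X + Y.im • dMat (fun y => α y Complex.I) w X := by
  have hs : ∀ (c : ℝ) X, MatDiffAt (fun y => c • α y X) w := fun c X i j =>
    (hα X i j).const_mul c
  rw [show (fun y => α y Y) = fun y => Y.re • α y 1 + Y.im • α y Complex.I from
    funext fun y => LForm.apply_eq α y Y, dMat_add (hs _ _) (hs _ _), dMat_const_smul _ (hα _),
    dMat_const_smul _ (hα _)]
  rfl

/-- The two brackets are `(1 - P) T + T (1 - P)` for `T = X(α(Y))` and `T = Y(α(X))`, and these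
derivatives agree. -/
theorem IsSurfaceOn.lie_formN_closed (hU : IsOpen U) (hL : IsSurfaceOn U L)
    (hα : IsTangentialOn U L α) (hw : w ∈ U) {X Y : ℂ} (hd : extD α w X Y = 0) :
    ⁅formN (projS L) w X, α w Y⁆ - ⁅formN (projS L) w Y, α w X⁆ = 0 := by
  have hP := (hL.projS_smooth hU hw).diff
  have hPP := hL.eventually_proj_idempotent hU hw
  have hA := fun X => (hα.smooth hU hw X).diff
  have hPA : ∀ X, ∀ᶠ y in 𝓝 w, projS L y * α y X = α y X := fun X =>
    Filter.Eventually.mono (hU.mem_nhds hw) fun y hy => hL.proj_mul hU hα hy X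
  have hAP : ∀ X, ∀ᶠ y in 𝓝 w, α y X * projS L y = α y X := fun X =>
    Filter.Eventually.mono (hU.mem_nhds hw) fun y hy => hL.mul_proj hU hα hy X
  rw [lie_formN hP hPP (hPA Y).self_of_nhds (hAP Y).self_of_nhds,
    lie_formN hP hPP (hPA X).self_of_nhds (hAP X).self_of_nhds,
    ← compl_mul_dMat hP (hA Y) (hPA Y), ← compl_mul_dMat hP (hA X) (hPA X),
    ← dMat_mul_compl hP (hA Y) (hAP Y), ← dMat_mul_compl hP (hA X) (hAP X)]
  rw [extD, sub_eq_zero] at hd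
  rw [hd, sub_self]

/-- The Hodge dual of a closed form with values in `L ∧ L^{(1)}` is `𝒟`-closed. -/
theorem IsSurfaceOn.divergence_eq (hU : IsOpen U) (hL : IsSurfaceOn U L)
    (hα : IsTangentialOn U L α) (hd : ∀ y ∈ U, ∀ X Y, extD α y X Y = 0) (hw : w ∈ U) :
    dMat (fun y => α y 1) w 1 + dMat (fun y => α y Complex.I) w Complex.I =
      ⁅formN (projS L) w 1, α w 1⁆ + ⁅formN (projS L) w Complex.I, α w Complex.I⁆ := by
  have hP := (hL.projS_smooth hU hw).diff
  have hPP := hL.eventually_proj_idempotent hU hw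
  have hA := fun X => (hα.smooth hU hw X).diff
  have hPA : ∀ X, ∀ᶠ y in 𝓝 w, projS L y * α y X = α y X := fun X =>
    Filter.Eventually.mono (hU.mem_nhds hw) fun y hy => hL.proj_mul hU hα hy X
  have hAP : ∀ X, ∀ᶠ y in 𝓝 w, α y X * projS L y = α y X := fun X =>
    Filter.Eventually.mono (hU.mem_nhds hw) fun y hy => hL.mul_proj hU hα hy X
  have key := hL.proj_divergence hU hw (A := fun y => α y 1) (B := fun y => α y Complex.I)
    (fun y hy => hα.smooth hU hy 1) (fun y hy => hα.smooth hU hy _)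
    (fun y hy => hα.2 y hy _) (fun y hy => hα.2 y hy _)
    fun y hy => sub_eq_zero.1 (hd y hy 1 Complex.I)
  have h0 : ∀ X Y, (1 - projS L w) * dMat (fun y => α y X) w Y * (1 - projS L w) = 0 :=
    fun X Y => by
    rw [compl_mul_dMat hP (hA X) (hPA X), mul_sub, mul_one, mul_assoc, (hAP X).self_of_nhds,
      sub_self]
  rw [lie_formN hP hPP (hPA _).self_of_nhds (hAP _).self_of_nhds,
    lie_formN hP hPP (hPA _).self_of_nhds (hAP _).self_of_nhds,
    ← compl_mul_dMat hP (hA _) (hPA _), ← compl_mul_dMat hP (hA _) (hPA _),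
    ← dMat_mul_compl hP (hA _) (hAP _), ← dMat_mul_compl hP (hA _) (hAP _)]
  have h1 := h0 1 1
  have h2 := h0 Complex.I Complex.I
  rw [← sub_eq_zero]
  generalize dMat (fun y => α y 1) w 1 = S at *
  generalize dMat (fun y => α y Complex.I) w Complex.I = T at *
  generalize projS L w = Q at *
  -- Removing `(1 - Q) S + S (1 - Q)` from `S` leaves the diagonal block on `S` minus the one on
  -- `S^⊥`: the former vanishes by `key` for the sum, the latter by `h0`.
  calc _ = Q * (S + T) * Q - (1 - Q) * S * (1 - Q) - (1 - Q) * T * (1 - Q) := by noncomm_ring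
    _ = 0 := by rw [key, h1, h2, sub_zero, sub_zero]

/-- The forms `X ↦ α(cX)` are `𝒟`-closed. -/
theorem IsSurfaceOn.extD_rotate (hU : IsOpen U) (hL : IsSurfaceOn U L)
    (hα : IsTangentialOn U L α) (hd : ∀ y ∈ U, ∀ X Y, extD α y X Y = 0) (hw : w ∈ U) (c X Y : ℂ) :
    dMat (fun y => α y (c * Y)) w X - dMat (fun y => α y (c * X)) w Y =
      ⁅formN (projS L) w X, α w (c * Y)⁆ - ⁅formN (projS L) w Y, α w (c * X)⁆ := by
  have hA := fun X => (hα.smooth hU hw X).diff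
  have h1 := hL.divergence_eq hU hα hd hw
  have h2 := hL.lie_formN_closed hU hα hw (hd w hw 1 Complex.I)
  have h3 := hd w hw 1 Complex.I
  rw [extD] at h3
  rw [dMat_form hA X (c * Y), dMat_form hA Y (c * X), LForm.apply_eq α w (c * Y),
    LForm.apply_eq α w (c * X), LForm.apply_eq (formN (projS L)) w X,
    LForm.apply_eq (formN (projS L)) w Y, dMat_apply_eq _ w X, dMat_apply_eq _ w Y,
    dMat_apply_eq (fun y => α y Complex.I) w X, dMat_apply_eq (fun y => α y Complex.I) w Y]
  simp only [Ring.lie_def] at h1 h2 ⊢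
  simp only [add_mul, mul_add, smul_mul_assoc, mul_smul_comm, Complex.mul_re, Complex.mul_im]
  -- A 2-form is its value on `(1, i)` times the area of `(X, Y)`, and `α(c ·) = Re c α - Im c *α`.
  linear_combination (norm := module) ((X.re * Y.im - X.im * Y.re) * c.re) • h3 -
    ((X.re * Y.im - X.im * Y.re) * c.re) • h2 - ((X.re * Y.im - X.im * Y.re) * c.im) • h1

end Tangential

/-! ### Isometries -/

/-- The inverse of an isometry. -/
def isomInv (F : Mat n) : Mat n := gram n * Fᵀ * gram n

theorem isomInv_mul {F : Mat n} (hF : ∀ u v, mink n (F *ᵥ u) (F *ᵥ v) = mink n u v) :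
    isomInv F * F = 1 := by
  have h : Fᵀ * gram n * F = gram n := by
    refine Matrix.ext_of_single_vecMul fun i => ?_
    refine dotProduct_eq _ _ fun v => ?_
    rw [← dotProduct_mulVec, ← dotProduct_mulVec, ← mink_apply, ← hF, mink_apply, ← mulVec_mulVec,
      ← mulVec_mulVec, dotProduct_mulVec _ Fᵀ, vecMul_transpose]
  rw [isomInv, mul_assoc, mul_assoc, ← mul_assoc Fᵀ, h, gram_mul_gram]

theorem mul_isomInv {F : Mat n} (hF : ∀ u v, mink n (F *ᵥ u) (F *ᵥ v) = mink n u v) :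
    F * isomInv F = 1 := mul_eq_one_comm.1 (isomInv_mul hF)

theorem MatSmoothAt.isomInv {F : ℂ → Mat n} {w : ℂ} (hF : MatSmoothAt F w) :
    MatSmoothAt (fun y => isomInv (F y)) w :=
  ((matSmoothAt_const _ w).mul hF.transpose).mul (matSmoothAt_const _ w)

theorem conj_wedge {F : Mat n} (hF : ∀ u v, mink n (F *ᵥ u) (F *ᵥ v) = mink n u v) (u v : Vec n) :
    F * wedge u v * isomInv F = wedge (F *ᵥ u) (F *ᵥ v) := mat_ext fun x => by
  have hx : x = F *ᵥ (isomInv F *ᵥ x) := by rw [mulVec_mulVec, mul_isomInv hF, one_mulVec]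
  rw [← mulVec_mulVec, ← mulVec_mulVec, wedge_mulVec, wedge_mulVec, mulVec_sub, mulVec_smul,
    mulVec_smul]
  conv_rhs => rw [hx, hF, hF]

theorem conj_mem_wedgeSpan {F : Mat n} (hF : ∀ u v, mink n (F *ᵥ u) (F *ᵥ v) = mink n u v)
    {A B : Submodule ℝ (Vec n)} {T : Mat n} (hT : T ∈ wedgeSpan A B) :
    F * T * isomInv F ∈ wedgeSpan (A.map (Matrix.toLin' F)) (B.map (Matrix.toLin' F)) := by
  induction hT using Submodule.span_induction with
  | mem T h =>
    obtain ⟨u, hu, v, hv, rfl⟩ := h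
    rw [conj_wedge hF]
    exact Submodule.subset_span ⟨_, ⟨u, hu, Matrix.toLin'_apply _ _⟩, _,
      ⟨v, hv, Matrix.toLin'_apply _ _⟩, rfl⟩
  | zero => rw [mul_zero, zero_mul]; exact Submodule.zero_mem _
  | add T T' _ _ h h' => rw [mul_add, add_mul]; exact Submodule.add_mem _ h h'
  | smul c T _ h => rw [mul_smul_comm, smul_mul_assoc]; exact Submodule.smul_mem _ _ h

/-! ### Gauge transformations of surfaces -/

section Gauge

variable {U : Set ℂ} {L : ℂ → Submodule ℝ (Vec n)} {w : ℂ} {σ : ℂ → Vec n} {F H : ℂ → Mat n}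

theorem IsLiftAt.map (hσ : IsLiftAt L w σ) (hF : ∀ᶠ y in 𝓝 w, MatSmoothAt F y)
    (hH : ∀ y, H y * F y = 1) :
    IsLiftAt (fun y => (L y).map (Matrix.toLin' (F y))) w fun y => F y *ᵥ σ y := by
  filter_upwards [hF, hσ] with y h1 h2
  refine ⟨h1.mulVec h2.1, fun h0 => h2.2.1 ?_, ?_⟩
  · rw [← one_mulVec (σ y), ← hH y, ← mulVec_mulVec, h0, mulVec_zero]
  · rw [h2.2.2, Submodule.map_span, Set.image_singleton, Matrix.toLin'_apply]

/-- `F` is a parallel isometry from the connection `𝒟 + 𝒩(c ·) + q(c' ·) - q` to `d`. -/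
structure IsGaugeOn (U : Set ℂ) (L : ℂ → Submodule ℝ (Vec n)) (q : LForm n) (c c' : ℂ)
    (F : ℂ → Mat n) : Prop where
  isom : ∀ y u v, mink n (F y *ᵥ u) (F y *ᵥ v) = mink n u v
  smooth : ∀ y ∈ U, MatSmoothAt F y
  dMat_eq : ∀ y ∈ U, ∀ X, dMat F y X = F y * (formN (projS L) y (c * X) - formN (projS L) y X
    + (q y (c' * X) - q y X))

/-- `F α(c ·) F⁻¹`. -/
def conjForm (F : ℂ → Mat n) (c : ℂ) (α : LForm n) : LForm n := fun w =>
  LinearMap.mulLeft ℝ (F w) ∘ₗ LinearMap.mulRight ℝ (isomInv (F w)) ∘ₗ α w ∘ₗ LinearMap.mulLeft ℝ c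

theorem conjForm_apply (F : ℂ → Mat n) (c : ℂ) (α : LForm n) (w X : ℂ) :
    conjForm F c α w X = F w * α w (c * X) * isomInv (F w) := by
  rw [mul_assoc]
  rfl

variable {q α : LForm n} {c c' : ℂ}

theorem IsGaugeOn.eventually_smooth (hF : IsGaugeOn U L q c c' F) (hU : IsOpen U) (hw : w ∈ U) :
    ∀ᶠ y in 𝓝 w, MatSmoothAt F y :=
  Filter.Eventually.mono (hU.mem_nhds hw) hF.smooth

theorem IsGaugeOn.isLiftAt (hF : IsGaugeOn U L q c c' F) (hU : IsOpen U) (hw : w ∈ U)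
    (hσ : IsLiftAt L w σ) :
    IsLiftAt (fun y => (L y).map (Matrix.toLin' (F y))) w fun y => F y *ᵥ σ y :=
  hσ.map (hF.eventually_smooth hU hw) fun y => isomInv_mul (hF.isom y)

/-- The conformality condition quantifies over all lifts of the transformed line; applying the
smooth inverse isometry pulls each one back. -/
theorem IsGaugeOn.exists_lift (hF : IsGaugeOn U L q c c' F) (hU : IsOpen U) (hw : w ∈ U)
    {τ : ℂ → Vec n} (hτ : IsLiftAt (fun y => (L y).map (Matrix.toLin' (F y))) w τ) :
    ∃ σ, IsLiftAt L w σ ∧ τ = fun y => F y *ᵥ σ y := by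
  have h := hτ.map (F := fun y => isomInv (F y))
    ((hF.eventually_smooth hU hw).mono fun y hy => hy.isomInv) fun y => mul_isomInv (hF.isom y)
  refine ⟨fun y => isomInv (F y) *ᵥ τ y, ?_, funext fun y => ?_⟩
  · convert h using 2 with y
    rw [← Submodule.map_comp, ← Matrix.toLin'_mul, isomInv_mul (hF.isom y), Matrix.toLin'_one,
      Submodule.map_id]
  · rw [mulVec_mulVec, mul_isomInv (hF.isom y), one_mulVec]

/-- Every term of `F⁻¹ dF` is a value of `𝒩` or `q`, and these annihilate `σ`. -/
theorem IsGaugeOn.fderiv_eq (hF : IsGaugeOn U L q c c' F) (hU : IsOpen U) (hL : IsSurfaceOn U L)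
    (hq : IsTangentialOn U L q) (hw : w ∈ U) (hσ : IsLiftAt L w σ) (X : ℂ) :
    fderiv ℝ (fun y => F y *ᵥ σ y) w X = F w *ᵥ fderiv ℝ σ w X := by
  rw [fderiv_mulVec_apply (hF.smooth w hw).diff hσ.diff, hF.dMat_eq w hw, ← mulVec_mulVec,
    add_mulVec, sub_mulVec, sub_mulVec, hL.formN_mulVec hU hw hσ, hL.formN_mulVec hU hw hσ,
    hL.tangential_mulVec hU hq hw hσ, hL.tangential_mulVec hU hq hw hσ]
  simp

theorem IsGaugeOn.derived_eq (hF : IsGaugeOn U L q c c' F) (hU : IsOpen U) (hL : IsSurfaceOn U L)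
    (hq : IsTangentialOn U L q) (hw : w ∈ U) :
    derived (fun y => (L y).map (Matrix.toLin' (F y))) w =
      (derived L w).map (Matrix.toLin' (F w)) := by
  obtain ⟨σ, hσ⟩ := (hL w hw).1
  rw [(hF.isLiftAt hU hw hσ).derived_eq, hσ.derived_eq, Submodule.map_span]
  simp only [pd, hF.fderiv_eq hU hL hq hw hσ, Set.image_insert_eq, Set.image_singleton,
    Matrix.toLin'_apply]

/-- A gauge transformation of a conformal immersion is a conformal immersion. -/
theorem IsGaugeOn.isSurfaceOn (hF : IsGaugeOn U L q c c' F) (hU : IsOpen U)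
    (hL : IsSurfaceOn U L) (hq : IsTangentialOn U L q) :
    IsSurfaceOn U fun y => (L y).map (Matrix.toLin' (F y)) := by
  intro w hw
  obtain ⟨⟨σ, hσ⟩, hnull, hrank, hconf⟩ := hL w hw
  refine ⟨⟨_, hF.isLiftAt hU hw hσ⟩, ?_, ?_, ?_⟩
  · rintro _ ⟨v, hv, rfl⟩
    rw [Matrix.toLin'_apply, hF.isom]
    exact hnull v hv
  · have hinj : Function.Injective (Matrix.toLin' (F w)) := fun u v h => by
      rw [Matrix.toLin'_apply, Matrix.toLin'_apply] at h
      rw [← one_mulVec u, ← one_mulVec v, ← isomInv_mul (hF.isom w), ← mulVec_mulVec, h,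
        mulVec_mulVec]
    rw [hF.derived_eq hU hL hq hw, ← hrank]
    exact (Submodule.equivMapOfInjective _ hinj _).finrank_eq.symm
  · intro τ hτ X Y
    obtain ⟨ρ, hρ, rfl⟩ := hF.exists_lift hU hw hτ
    simp only [hF.fderiv_eq hU hL hq hw hρ, hF.isom]
    exact hconf ρ hρ X Y

theorem IsGaugeOn.isTangentialOn (hF : IsGaugeOn U L q c c' F) (hU : IsOpen U)
    (hL : IsSurfaceOn U L) (hq : IsTangentialOn U L q) (hα : IsTangentialOn U L α) :
    IsTangentialOn U (fun y => (L y).map (Matrix.toLin' (F y))) (conjForm F c α) := by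
  refine ⟨fun X i j w hw => ContDiffAt.contDiffWithinAt ?_, fun w hw X => ?_⟩
  · have hFw := hF.smooth w hw
    have h := ((hFw.mul (hα.smooth hU hw (c * X))).mul hFw.isomInv) i j
    simpa only [conjForm_apply] using h
  · rw [conjForm_apply, hF.derived_eq hU hL hq hw]
    exact conj_mem_wedgeSpan (hF.isom w) (hα.2 w hw _)

/-- The gauge transform of a rotated closed form is closed. -/
theorem IsGaugeOn.extD_conjForm (hF : IsGaugeOn U L q c c' F) (hU : IsOpen U)
    (hL : IsSurfaceOn U L) (hq : IsTangentialOn U L q) (hα : IsTangentialOn U L α)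
    (hd : ∀ y ∈ U, ∀ X Y, extD α y X Y = 0) (hw : w ∈ U) (X Y : ℂ) :
    extD (conjForm F c α) w X Y = 0 := by
  have hFw := hF.smooth w hw
  have hA := fun Z => (hα.smooth hU hw Z).diff
  set B : ℂ → Mat n := fun X => formN (projS L) w (c * X) - formN (projS L) w X
    + (q w (c' * X) - q w X) with hB
  have hFB : ∀ X, dMat F w X = F w * B X := hF.dMat_eq w hw
  have hI : ∀ X, dMat (fun y => isomInv (F y)) w X = -(B X * isomInv (F w)) := fun X => by
    have h := dMat_mul hFw.diff hFw.isomInv.diff X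
    rw [show (fun y => F y * isomInv (F y)) = fun _ => 1 from
      funext fun y => mul_isomInv (hF.isom y), dMat_const, hFB, LinearMap.zero_apply] at h
    have h1 := congrArg (isomInv (F w) * ·) h
    simp only [mul_zero, mul_add, ← mul_assoc, isomInv_mul (hF.isom w), one_mul] at h1
    exact eq_neg_of_add_eq_zero_right h1.symm
  -- Differentiating a conjugate by `F` adds the bracket with `B = F⁻¹ dF`.
  have hD : ∀ X Z, dMat (fun y => F y * α y Z * isomInv (F y)) w X =
      F w * (dMat (fun y => α y Z) w X + ⁅B X, α w Z⁆) * isomInv (F w) := fun X Z => by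
    rw [dMat_mul (hFw.diff.mul (hA Z)) hFw.isomInv.diff, dMat_mul hFw.diff (hA Z), hFB, hI,
      Ring.lie_def]
    noncomm_ring
  have hrot := hL.extD_rotate hU hα hd hw c X Y
  -- Taken at the rotated vectors, this disposes of `𝒩(c ·)`; the remaining `-𝒩` turns `d` into
  -- `d^𝒟`, which is `hrot`.
  have hcl := hL.lie_formN_closed hU hα hw (hd w hw (c * X) (c * Y))
  have hBα : ∀ X Z, ⁅B X, α w Z⁆ = ⁅formN (projS L) w (c * X), α w Z⁆
      - ⁅formN (projS L) w X, α w Z⁆ := fun X Z => by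
    have h1 := hL.lie_eq_zero hU hq hα hw (c' * X) Z
    have h2 := hL.lie_eq_zero hU hq hα hw X Z
    simp only [hB, Ring.lie_def] at h1 h2 ⊢
    linear_combination (norm := noncomm_ring) h1 - h2
  simp only [extD, conjForm_apply]
  rw [hD, hD, ← sub_mul, ← mul_sub, hBα, hBα]
  have : dMat (fun y => α y (c * Y)) w X + (⁅formN (projS L) w (c * X), α w (c * Y)⁆
      - ⁅formN (projS L) w X, α w (c * Y)⁆) - (dMat (fun y => α y (c * X)) w Y +
      (⁅formN (projS L) w (c * Y), α w (c * X)⁆ - ⁅formN (projS L) w Y, α w (c * X)⁆)) = 0 := by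
    linear_combination (norm := abel) hrot + hcl
  rw [this, mul_zero, zero_mul]

end Gauge

/-! ### Complexification -/

theorem vecC_injective : Function.Injective (vecC (n := n)) := fun u v h => by
  funext i
  exact Complex.ofReal_injective (congrFun h i)

theorem toC_mul (A B : Mat n) : toC (A * B) = toC A * toC B :=
  Matrix.map_mul (f := Complex.ofRealHom)

theorem toC_one : toC (1 : Mat n) = 1 :=
  Matrix.map_one _ Complex.ofReal_zero Complex.ofReal_one

theorem toC_add (A B : Mat n) : toC (A + B) = toC A + toC B := by
  ext i j; simp [toC]

theorem toC_sub (A B : Mat n) : toC (A - B) = toC A - toC B := by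
  ext i j; simp [toC]

theorem toC_smul (r : ℝ) (A : Mat n) : toC (r • A) = (r : ℂ) • toC A := by
  ext i j; simp [toC]

theorem vecC_add (u v : Vec n) : vecC (u + v) = vecC u + vecC v := by
  ext i; simp [vecC]

theorem vecC_mulVec (A : Mat n) (v : Vec n) : vecC (A *ᵥ v) = toC A *ᵥ vecC v := by
  ext i; simp [vecC, toC, Matrix.mulVec, dotProduct]

/-- For unimodular `l`, the form `l⁻¹ α^{1,0} + l α^{0,1}` is the real form `α(l⁻¹ ·)`. -/
theorem spectralForm_eq {T : Type*} [AddCommGroup T] [Module ℂ T] [Module ℝ T] [IsScalarTower ℝ ℂ T]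
    {l : ℂ} (hl : ‖l‖ = 1) (α : T →ₗ[ℝ] Mat n) (X : T) :
    spectralForm l α X = toC (α (l⁻¹ • X)) := by
  have h1 : l⁻¹ = (starRingEnd ℂ) l := Complex.inv_eq_conj hl
  have h2 : l⁻¹ • X = l.re • X - l.im • (Complex.I • X) := by
    have : l⁻¹ = (l.re : ℂ) - (l.im : ℂ) * Complex.I := by
      rw [h1]; apply Complex.ext <;> simp
    rw [this, sub_smul, mul_smul, ← algebraMap_smul ℂ l.re X, ← algebraMap_smul ℂ l.im]
    rfl
  rw [h2, map_sub, map_smul, map_smul, toC_sub, toC_smul, toC_smul, spectralForm, part10, part01]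
  rw [h1]
  conv_lhs => rw [← Complex.re_add_im l]
  ext i j
  simp only [map_add, map_mul, Complex.conj_ofReal, Complex.conj_I, Matrix.add_apply,
    Matrix.smul_apply, Matrix.sub_apply, smul_eq_mul]
  linear_combination ((l.im : ℂ) * toC (α (Complex.I • X)) i j) * Complex.I_mul_I

theorem part10_add_part01 {T : Type*} [SMul ℂ T] (α : T → Mat n) (X : T) :
    part10 α X + part01 α X = toC (α X) := by
  rw [part10, part01]
  module

/-! ### Spectral deformations -/

section Spectral

variable {M : Type*} [TopologicalSpace M] [ChartedSpace ℂ M] {Λ : M → Submodule ℝ (Vec n)}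
  {q η : Form n M} {l : ℂ} {φ : M → Mat n}

/-- The `q` terms are the spectral form of parameter `l ^ 2` minus `q` itself, so the connection is
real and its rotations are by `l⁻¹` and `l⁻²`. -/
theorem spectralConn_eq (L : ℂ → Submodule ℝ (Vec n)) (q : LForm n) (hl : ‖l‖ = 1)
    (s : ℂ → Vec n) (w X : ℂ) :
    spectralConn L q l s w X = vecC (connD (projS L) s w X +
      (formN (projS L) w (l⁻¹ * X) + (q w ((l ^ 2)⁻¹ * X) - q w X)) *ᵥ s w) := by
  have h1 := spectralForm_eq hl (formN (projS L) w) X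
  have h2 := spectralForm_eq (l := l ^ 2) (by rw [norm_pow, hl, one_pow]) (q w) X
  rw [smul_eq_mul] at h1 h2
  rw [spectralConn, vecC_add, vecC_mulVec, toC_add, toC_sub, ← h1, ← h2, ← part10_add_part01 (q w),
    spectralForm, spectralForm]
  congr 2
  module

theorem IsSpectralGauge.isGaugeOn (hφ : IsSpectralGauge Λ q l φ) (hl : ‖l‖ = 1)
    (hΛ : IsSurface Λ) {e : OpenPartialHomeomorph M ℂ} (he : IsHolChart e) :
    IsGaugeOn e.target (localLine e Λ) (localForm e q) l⁻¹ (l ^ 2)⁻¹ fun w => φ (e.symm w) where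
  isom y := hφ.isometry _
  smooth y hy i j := (hφ.smooth e he i j).contDiffAt (e.open_target.mem_nhds hy)
  dMat_eq y hy X := by
    have hL := hΛ e he
    have hP := (hL.projS_smooth e.open_target hy).diff
    have hφd : MatDiffAt (fun w => φ (e.symm w)) y := fun i j =>
      ((hφ.smooth e he i j).contDiffAt (e.open_target.mem_nhds hy)).differentiableAt (by simp)
    refine mat_ext fun v => ?_
    -- On constant sections `𝒟 v = -𝒩 v`, so parallelism becomes the formula for `dF`.
    have h := hφ.parallel e he y hy (fun _ => v) contDiffAt_const X
    rw [spectralConn_eq _ _ hl, ← vecC_mulVec] at h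
    have h1 := vecC_injective h
    rw [fderiv_mulVec_apply hφd (differentiableAt_const v)] at h1
    have h2 := fderiv_eq_connD_add_formN hP (differentiableAt_const v)
      (hL.proj_idempotent e.open_target hy) X
    simp only [fderiv_fun_const, Pi.zero_apply, _root_.zero_apply, mulVec_zero, add_zero] at h1 h2
    rw [h1, eq_neg_of_add_eq_zero_left h2.symm, ← mulVec_mulVec]
    congr 1
    simp only [add_mulVec, sub_mulVec]
    abel

/-- The real form `Ad_φ (l⁻¹ η^{1,0} + l η^{0,1}) = φ η(l⁻¹ ·) φ⁻¹`. -/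
def spectralTransform (φ : M → Mat n) (l : ℂ) (η : Form n M) : Form n M := fun x =>
  { toFun := fun X => φ x * η x (l⁻¹ • X) * isomInv (φ x)
    map_add' := fun X Y => by rw [smul_add, map_add, mul_add, add_mul]
    map_smul' := fun r X => by
      rw [smul_comm, map_smul, mul_smul_comm, smul_mul_assoc, RingHom.id_apply] }

/-- The chart derivative is complex linear, so multiplication by `l⁻¹` on tangent vectors becomes
multiplication by `l⁻¹` in the coordinate. -/
theorem localForm_spectralTransform (e : OpenPartialHomeomorph M ℂ) :
    localForm e (spectralTransform φ l η) =
      conjForm (fun w => φ (e.symm w)) l⁻¹ (localForm e η) := by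
  funext w
  refine LinearMap.ext fun X => ?_
  rw [conjForm_apply]
  change φ (e.symm w) * η (e.symm w) (l⁻¹ • mfderiv 𝓘(ℂ) 𝓘(ℂ) e.symm w X) *
      isomInv (φ (e.symm w)) = φ (e.symm w) * η (e.symm w)
      (mfderiv 𝓘(ℂ) 𝓘(ℂ) e.symm w (l⁻¹ • X)) * isomInv (φ (e.symm w))
  rw [← (mfderiv 𝓘(ℂ) 𝓘(ℂ) e.symm w).map_smul l⁻¹ X]
  rfl

theorem toC_spectralTransform (hφ : IsSpectralGauge Λ q l φ) (hl : ‖l‖ = 1) (x : M)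
    (X : TangentSpace 𝓘(ℂ) x) : toC (spectralTransform φ l η x X) =
      toC (φ x) * spectralForm l (η x) X * (toC (φ x))⁻¹ := by
  have hinv : (toC (φ x))⁻¹ = toC (isomInv (φ x)) := Matrix.inv_eq_right_inv (by
    rw [← toC_mul, mul_isomInv (hφ.isometry x), toC_one])
  have : IsScalarTower ℝ ℂ (TangentSpace 𝓘(ℂ) x) := inferInstanceAs (IsScalarTower ℝ ℂ ℂ)
  rw [hinv, spectralForm_eq hl, ← toC_mul, ← toC_mul]
  rfl

theorem IsSpectralGauge.isIsothermic (hφ : IsSpectralGauge Λ q l φ) (hl : ‖l‖ = 1)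
    (hq : IsTangential Λ q) (hη : IsIsothermic Λ η) :
    IsIsothermic (applyGauge φ Λ) (spectralTransform φ l η) where
  surface e he := (hφ.isGaugeOn hl hη.surface he).isSurfaceOn e.open_target (hη.surface e he)
    (hq e he)
  tangential e he := by
    rw [localForm_spectralTransform]
    exact (hφ.isGaugeOn hl hη.surface he).isTangentialOn e.open_target (hη.surface e he) (hq e he)
      (hη.tangential e he)
  closed e he w hw X Y := by
    rw [localForm_spectralTransform]
    exact (hφ.isGaugeOn hl hη.surface he).extD_conjForm e.open_target (hη.surface e he) (hq e he)
      (hη.tangential e he) (hη.closed e he) hw X Y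
  nonzero := by
    obtain ⟨x, hx⟩ := hη.nonzero
    refine ⟨x, fun h0 => hx (LinearMap.ext fun X => ?_)⟩
    have hl0 : l ≠ 0 := fun h => by simp [h] at hl
    -- Evaluation at `l • X` undoes the rotation; conjugating back by `φ x` then recovers `η x X`.
    have h : φ x * η x (l⁻¹ • l • X) * isomInv (φ x) = 0 := LinearMap.congr_fun h0 (l • X)
    rw [inv_smul_smul₀ hl0] at h
    have h1 := congrArg (fun T => isomInv (φ x) * T * φ x) h
    simp only [mul_zero, zero_mul] at h1
    rw [← mul_assoc, mul_assoc _ _ (φ x), isomInv_mul (hφ.isometry x), mul_one, ← mul_assoc,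
      isomInv_mul (hφ.isometry x), one_mul] at h1
    exact h1

end Spectral

end LightCone

end

theorem mainTheorem9 (n : ℕ) (hn : 3 ≤ n)
    {M : Type*} [TopologicalSpace M] [ChartedSpace ℂ M] [IsManifold 𝓘(ℂ) ω M]
    (Λ : M → Submodule ℝ (Vec n)) (q η : Form n M)
    (hq : IsConstrainedWillmore Λ q) (hη : IsIsothermic Λ η)
    (l : ℂ) (hl : ‖l‖ = 1)
    (φ : M → Mat n) (hφ : IsSpectralGauge Λ q l φ) :
    ∃ η' : Form n M,
      (∀ (x : M) (X : TangentSpace 𝓘(ℂ) x),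
        toC (η' x X) = toC (φ x) * spectralForm l (η x) X * (toC (φ x))⁻¹) ∧
      IsIsothermic (applyGauge φ Λ) η' := by
  exact ⟨spectralTransform φ l η, toC_spectralTransform hφ hl,
    hφ.isIsothermic hl hq.tangential hη⟩
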